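/- Let $G$ be an infinite finitely generated abelian group and let $\mu$ be a finitely supported probability measure on $G$ whose support is not contained in a coset of a finite subgroup (this holds, for instance, whenever the support of $\mu$ generates $G$ as a semigroup). Let $X_n=s_1\cdots s_n$, where the $s_k$ are independent of law $\mu$, and let $X'_n$ be an independent copy of $X_n$. For $\rho\in(0,1)$ let $Y_n^\rho=r_1\cdots r_n$, where independently for each $k$ one puts $r_k=s_k$ with probability $1-\rho$ and $r_k=s'_k$ with probability $\rho$, the $s'_k$ being independent of law $\mu$, and independent of the $s_k$ and of the choices. Write $H$ for the Shannon entropy and $H(\cdot\mid\cdot)$ for the conditional Shannon entropy, $\pi_n^\rho$ for the law of $(X_n,Y_n^\rho)$ on $G\times G$, and $\mu_n$ for the law of $X_n$. Then: 1. $(G,\mu)$ is entropy noise sensitive: for every $\rho\in(0,1)$, $$\frac{H(Y_n^\rho\mid X_n)}{H(X_n)}\longrightarrow 1\qquad(n\to\infty).$$ 2. For every finite generating set $T$ of $G$, with associated word distance $d_T$, $(G,\mu)$ is neither noise sensitive nor partially noise sensitive in average distance. That is, it is not true that $$\liminf_{n\to\infty}\frac{\mathbb E\,d_T(X_n,Y_n^\rho)}{\mathbb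 E\,d_T(X_n,X'_n)}\ge 1\quad\text{for every }\rho\in(0,1),$$ and there is no $c>0$ such that for every $\rho\in(0,1)$ one has $\mathbb E\,d_T(X_n,Y_n^\rho)\ge c\,\mathbb E\,d_T(X_n,X'_n)$ for all sufficiently large $n$. 3. $(G,\mu)$ is not $\ell^1$-noise sensitive: it is not true that for every $\rho\in(0,1)$ $$\sum_{(x,y)\in G\times G}\bigl|\pi_n^\rho(x,y)-\mu_n(x)\mu_n(y)\bigr|\longrightarrow 0\qquad(n\to\infty).$$ -/

import Mathlib

open Filter Topology

namespace NoiseWalk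

noncomputable section

/-- The law of a biased coin showing `true` with probability `ρ`. -/
def coin (ρ : unitInterval) : PMF Bool :=
  PMF.ofFintype
    (fun b => if b then ENNReal.ofReal (ρ : ℝ) else ENNReal.ofReal (1 - (ρ : ℝ)))
    (by
      rw [Fintype.sum_bool, if_pos rfl, if_neg Bool.false_ne_true,
        ← ENNReal.ofReal_add ρ.2.1 (sub_nonneg.2 ρ.2.2)]
      simp)

/-- The law of the position at time `n` of the random walk with step law `μ`, i.e. the law of
`s₁ s₂ ⋯ sₙ` with `sₖ` independent of law `μ` (the `n`-fold convolution power of `μ`). -/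
def walk {G : Type*} [Group G] (μ : PMF G) : ℕ → PMF G
  | 0 => PMF.pure 1
  | n + 1 => (walk μ n).bind fun x => μ.bind fun s => PMF.pure (x * s)

/-- The law of a pair of independent variables of laws `ξ` and `η`. -/
def indep {E F : Type*} (ξ : PMF E) (η : PMF F) : PMF (E × F) :=
  ξ.bind fun x => η.bind fun y => PMF.pure (x, y)

/-- The law of one increment and its noised version: `(s, r)`, where `s` has law `μ`, and `r` is
`s` with probability `1 - ρ` and an independent sample `s'` of law `μ` with probability `ρ`. -/
def noisyStep {G : Type*} (μ : PMF G) (ρ : unitInterval) : PMF (G × G) :=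
  μ.bind fun s => μ.bind fun s' => (coin ρ).bind fun refresh =>
    PMF.pure (s, if refresh then s' else s)

/-- The joint law of `(Xₙ, Yₙ^ρ)`, where `Xₙ = s₁ ⋯ sₙ` and `Yₙ^ρ = r₁ ⋯ rₙ`, the pairs
`(sₖ, rₖ)` being independent of law `noisyStep μ ρ`. -/
def noisyLaw {G : Type*} [Group G] (μ : PMF G) (ρ : unitInterval) (n : ℕ) : PMF (G × G) :=
  walk (noisyStep μ ρ) n

/-- The law of a pair `(Xₙ, X'ₙ)` of two independent samples of the random walk. -/
def indepLaw {G : Type*} [Group G] (μ : PMF G) (n : ℕ) : PMF (G × G) :=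
  indep (walk μ n) (walk μ n)

/-- The `ℓ¹`-distance between two laws. -/
def l1Dist {E : Type*} (ξ η : PMF E) : ℝ :=
  ∑' x, |(ξ x).toReal - (η x).toReal|

/-- The Shannon entropy `-∑ ξ(x) log ξ(x)` (meaningful for laws of finite entropy, in particular
for the finitely supported ones). -/
def entropy {E : Type*} (ξ : PMF E) : ℝ :=
  ∑' x, Real.negMulLog (ξ x).toReal

/-- The conditional entropy `H(Y | X)` when `(X, Y)` has law `π`, that is
`∑ₓ P(X = x) (-∑_y P(Y = y | X = x) log P(Y = y | X = x))`. -/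
def condEntropy {E F : Type*} (π : PMF (E × F)) : ℝ :=
  ∑' x, ((π.map Prod.fst) x).toReal *
    ∑' y, Real.negMulLog ((π (x, y)).toReal / ((π.map Prod.fst) x).toReal)

/-- The word length of `g` with respect to `T`: the least length of a word in the letters
`T ∪ T⁻¹` that represents `g` (meaningful when `T` generates the group). -/
def wordLength {G : Type*} [Group G] (T : Set G) (g : G) : ℕ :=
  sInf {n | ∃ l : List G, (∀ x ∈ l, x ∈ T ∨ x⁻¹ ∈ T) ∧ l.prod = g ∧ l.length = n}

/-- The left-invariant word distance with respect to `T`. -/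
def wordDist {G : Type*} [Group G] (T : Set G) (g h : G) : ℕ :=
  wordLength T (g⁻¹ * h)

/-- The expected word distance `E d(X, Y)` when `(X, Y)` has law `π` (meaningful when this is
finite, in particular for finitely supported `π`). -/
def expDist {G : Type*} [Group G] (T : Set G) (π : PMF (G × G)) : ℝ :=
  ∑' p : G × G, (π p).toReal * (wordDist T p.1 p.2 : ℝ)

/-- `ℓ¹`-noise sensitivity of the random walk with step law `μ`. -/
def L1NoiseSensitive {G : Type*} [Group G] (μ : PMF G) : Prop :=
  ∀ ρ : unitInterval, 0 < ρ → ρ < 1 →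
    Tendsto (fun n => l1Dist (noisyLaw μ ρ n) (indepLaw μ n)) atTop (𝓝 0)

/-- Entropy noise sensitivity: `H(Yₙ^ρ | Xₙ) / H(Xₙ) → 1` for every `ρ ∈ (0, 1)`. -/
def EntropyNoiseSensitive {G : Type*} [Group G] (μ : PMF G) : Prop :=
  ∀ ρ : unitInterval, 0 < ρ → ρ < 1 →
    Tendsto (fun n => condEntropy (noisyLaw μ ρ n) / entropy (walk μ n)) atTop (𝓝 1)

/-- Noise sensitivity in average word distance: for every `ρ ∈ (0, 1)`,
`liminf E d(Xₙ, Yₙ^ρ) / E d(Xₙ, X'ₙ) ≥ 1`. The lower limit is taken in the extended reals. -/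
def DistNoiseSensitive {G : Type*} [Group G] (T : Set G) (μ : PMF G) : Prop :=
  ∀ ρ : unitInterval, 0 < ρ → ρ < 1 →
    (1 : EReal) ≤ liminf
      (fun n => ((expDist T (noisyLaw μ ρ n) / expDist T (indepLaw μ n) : ℝ) : EReal)) atTop

/-- Partial noise sensitivity in average word distance: there is `c > 0` such that for every
`ρ ∈ (0, 1)`, `E d(Xₙ, Yₙ^ρ) ≥ c E d(Xₙ, X'ₙ)` for all large `n`. -/
def PartiallyDistNoiseSensitive {G : Type*} [Group G] (T : Set G) (μ : PMF G) : Prop :=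
  ∃ c : ℝ, 0 < c ∧ ∀ ρ : unitInterval, 0 < ρ → ρ < 1 →
    ∀ᶠ n in atTop, c * expDist T (indepLaw μ n) ≤ expDist T (noisyLaw μ ρ n)

end

end NoiseWalk

/-! Fix `s₀` in the support of `μ` and let `d` be the rank of the group `D` generated by the
differences `s * s₀⁻¹`. The coset hypothesis says that `D` is infinite, so `d ≥ 1`.
`exists_dual_differences` makes this concrete: it gives `d` differences and `d` homomorphisms to `ℤ`
that are dual to them up to nonzero factors and have finite common kernel on `D`.

Entropy. In each of the `d` integer coordinates the walk fluctuates on scale `√n`, so Gibbs'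
inequality against a product of exponential weights of that width gives `H(Xₙ) ≤ (d/2) log n + C`
(`exists_entropy_walk_le`). The pair `(Xₙ, Yₙ)` is itself a random walk on `G × G`. Since `ρ > 0`,
its step law charges every pair of points of the support of `μ`, so its differences have rank `2d`.
Anticoncentration (`exists_walk_le`) bounds all its atoms by a multiple of `n ^ (-d)`, whence `H(Xₙ,
Yₙ) ≥ d log n - C'`. By the chain rule, `H(Yₙ | Xₙ) = H(Xₙ, Yₙ) - H(Xₙ)` is at least `H(Xₙ)` minus a
constant. It is also at most `H(Yₙ) = H(Xₙ)`, which tends to infinity, so the ratio tends to `1`.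

Distance and `ℓ¹`. For a homomorphism `f` to `ℤ`, the displacement `f(Yₙ) - f(Xₙ)` is a centred walk
of variance proportional to `ρ n`. For two independent walks the displacement is of order `√n`, by
anticoncentration of `f(Xₙ)`. Word length is comparable with the integer coordinates, so taking `ρ`
small makes the noised distance an arbitrarily small fraction of the independent one. The event that
the displacement is at most `κ √n` then separates the two joint laws in `ℓ¹`. -/

namespace NoiseWalk

noncomputable section

open scoped ENNReal

/-- The expectation of `f` under `ξ` (meaningful for finitely supported laws). -/
def mean {E : Type*} (ξ : PMF E) (f : E → ℝ) : ℝ :=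
  ∑' x, (ξ x).toReal * f x

/-! ### Expectations under finitely supported laws -/

section Mean

variable {E F : Type*} {ξ : PMF E}

lemma mean_eq_sum (S : Finset E) (hS : ξ.support ⊆ S) (f : E → ℝ) :
    mean ξ f = ∑ x ∈ S, (ξ x).toReal * f x := by
  refine tsum_eq_sum fun x hx => ?_
  have : ξ x = 0 := by
    by_contra h
    exact hx (hS ((PMF.mem_support_iff _ _).2 h))
  simp [this]

lemma sum_toReal_eq_one (S : Finset E) (hS : ξ.support ⊆ S) :
    ∑ x ∈ S, (ξ x).toReal = 1 := by
  have h := ξ.tsum_coe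
  rw [tsum_eq_sum (s := S) fun x hx => ?_] at h
  · rw [← ENNReal.toReal_sum fun x _ => ξ.apply_ne_top x, h, ENNReal.toReal_one]
  · by_contra h0
    exact hx (hS ((PMF.mem_support_iff _ _).2 h0))

lemma mean_pure (x : E) (f : E → ℝ) : mean (PMF.pure x) f = f x := by
  classical
  rw [mean_eq_sum {x} (by simp)]
  simp

lemma mean_const (hξ : ξ.support.Finite) (c : ℝ) : mean ξ (fun _ => c) = c := by
  rw [mean_eq_sum hξ.toFinset (by simp), ← Finset.sum_mul, sum_toReal_eq_one _ (by simp), one_mul]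

lemma mean_add (hξ : ξ.support.Finite) (f g : E → ℝ) :
    mean ξ (fun x => f x + g x) = mean ξ f + mean ξ g := by
  simp only [mean_eq_sum hξ.toFinset (by simp : ξ.support ⊆ _), mul_add, Finset.sum_add_distrib]

lemma mean_sub (hξ : ξ.support.Finite) (f g : E → ℝ) :
    mean ξ (fun x => f x - g x) = mean ξ f - mean ξ g := by
  simp only [mean_eq_sum hξ.toFinset (by simp : ξ.support ⊆ _), mul_sub, Finset.sum_sub_distrib]

lemma mean_const_mul (c : ℝ) (f : E → ℝ) :
    mean ξ (fun x => c * f x) = c * mean ξ f := by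
  simp only [mean, mul_left_comm, tsum_mul_left]

lemma mean_sum {ι : Type*} (hξ : ξ.support.Finite) (s : Finset ι) (f : ι → E → ℝ) :
    mean ξ (fun x => ∑ i ∈ s, f i x) = ∑ i ∈ s, mean ξ (f i) := by
  simp only [mean_eq_sum hξ.toFinset (by simp : ξ.support ⊆ _), Finset.mul_sum]
  exact Finset.sum_comm

lemma mean_mono (hξ : ξ.support.Finite) {f g : E → ℝ} (h : ∀ x ∈ ξ.support, f x ≤ g x) :
    mean ξ f ≤ mean ξ g := by
  simp only [mean_eq_sum hξ.toFinset (by simp : ξ.support ⊆ _)]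
  refine Finset.sum_le_sum fun x hx => ?_
  exact mul_le_mul_of_nonneg_left (h x (by simpa using hx)) ENNReal.toReal_nonneg

lemma mean_nonneg {f : E → ℝ} (h : ∀ x, 0 ≤ f x) : 0 ≤ mean ξ f :=
  tsum_nonneg fun x => mul_nonneg ENNReal.toReal_nonneg (h x)

lemma finite_support_bind {κ : E → PMF F} (hξ : ξ.support.Finite)
    (hκ : ∀ x ∈ ξ.support, (κ x).support.Finite) : (ξ.bind κ).support.Finite := by
  rw [PMF.support_bind]
  exact hξ.biUnion hκ

lemma mean_bind {κ : E → PMF F} (hξ : ξ.support.Finite)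
    (hκ : ∀ x ∈ ξ.support, (κ x).support.Finite) (f : F → ℝ) :
    mean (ξ.bind κ) f = mean ξ fun x => mean (κ x) f := by
  have hT := finite_support_bind hξ hκ
  rw [mean_eq_sum hT.toFinset (by simp), mean_eq_sum hξ.toFinset (by simp)]
  have h1 : ∀ y, ((ξ.bind κ) y).toReal = ∑ x ∈ hξ.toFinset, (ξ x).toReal * (κ x y).toReal := by
    intro y
    rw [PMF.bind_apply, ENNReal.tsum_toReal_eq
      fun x => ENNReal.mul_ne_top (ξ.apply_ne_top x) ((κ x).apply_ne_top y)]
    simp only [ENNReal.toReal_mul]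
    exact mean_eq_sum hξ.toFinset (by simp) fun x => (κ x y).toReal
  have h2 : ∀ x ∈ hξ.toFinset, (ξ x).toReal * mean (κ x) f =
      ∑ y ∈ hT.toFinset, (ξ x).toReal * (κ x y).toReal * f y := by
    intro x hx
    rw [mean_eq_sum hT.toFinset, Finset.mul_sum]
    · simp only [mul_assoc]
    · intro y hy
      rw [Set.Finite.coe_toFinset, PMF.support_bind]
      exact Set.mem_biUnion (by simpa using hx) hy
  rw [Finset.sum_congr rfl h2, Finset.sum_comm]
  exact Finset.sum_congr rfl fun y _ => by rw [h1, Finset.sum_mul]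

lemma finite_support_pure (x : E) : (PMF.pure x).support.Finite := by simp

lemma finite_support_map (hξ : ξ.support.Finite) (g : E → F) : (ξ.map g).support.Finite := by
  rw [PMF.support_map]
  exact hξ.image g

lemma mean_map (hξ : ξ.support.Finite) (g : E → F) (f : F → ℝ) :
    mean (ξ.map g) f = mean ξ (f ∘ g) := by
  rw [PMF.map, mean_bind hξ fun x _ => by simp]
  simp only [Function.comp_def, mean_pure]

lemma finite_support_indep {η : PMF F} (hξ : ξ.support.Finite) (hη : η.support.Finite) :
    (indep ξ η).support.Finite :=
  finite_support_bind hξ fun _ _ => finite_support_bind hη fun _ _ => finite_support_pure _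

lemma mean_indep {η : PMF F} (hξ : ξ.support.Finite) (hη : η.support.Finite) (f : E × F → ℝ) :
    mean (indep ξ η) f = mean ξ fun x => mean η fun y => f (x, y) := by
  rw [indep, mean_bind hξ fun _ _ => finite_support_bind hη fun _ _ => finite_support_pure _]
  congr 1
  ext x
  rw [mean_bind hη fun _ _ => finite_support_pure _]
  simp only [mean_pure]

/-- The mean absolute value is controlled by the second moment. -/
lemma mean_abs_le (hξ : ξ.support.Finite) (f : E → ℝ) {v : ℝ}
    (hv : mean ξ (fun x => f x ^ 2) ≤ v) : mean ξ (fun x => |f x|) ≤ √v := by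
  refine Real.le_sqrt_of_sq_le (le_trans ?_ hv)
  set m := mean ξ (fun x => |f x|)
  have h : 0 ≤ mean ξ (fun x => (|f x| - m) ^ 2) := mean_nonneg fun x => sq_nonneg _
  have e : mean ξ (fun x => (|f x| - m) ^ 2) = mean ξ (fun x => f x ^ 2) - m ^ 2 := by
    have : (fun x => (|f x| - m) ^ 2) = fun x => f x ^ 2 + ((-2 * m) * |f x| + m ^ 2) := by
      ext x
      rw [sub_sq, sq_abs]
      ring
    rw [this, mean_add hξ, mean_add hξ, mean_const_mul, mean_const hξ]
    ring
  linarith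

end Mean

/-! ### Random walks: supports, images under homomorphisms, variance -/

section Walk

variable {A B : Type*} [Group A] [Group B] {ν : PMF A}

lemma finite_support_walk (hν : ν.support.Finite) (n : ℕ) : (walk ν n).support.Finite := by
  induction n with
  | zero => exact finite_support_pure _
  | succ n ih =>
    exact finite_support_bind ih fun _ _ => finite_support_bind hν fun _ _ => finite_support_pure _

lemma mean_walk_succ (hν : ν.support.Finite) (n : ℕ) (f : A → ℝ) :
    mean (walk ν (n + 1)) f = mean (walk ν n) fun x => mean ν fun s => f (x * s) := by
  rw [walk, mean_bind (finite_support_walk hν n)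
    fun _ _ => finite_support_bind hν fun _ _ => finite_support_pure _]
  congr 1
  ext x
  rw [mean_bind hν fun _ _ => finite_support_pure _]
  simp only [mean_pure]

lemma walk_map (φ : A →* B) (n : ℕ) : (walk ν n).map φ = walk (ν.map φ) n := by
  induction n with
  | zero => simp [walk, PMF.pure_map]
  | succ n ih =>
    simp only [walk, PMF.map_bind, PMF.pure_map, map_mul, ← ih, PMF.bind_map]
    rfl

/-- The variance of an additive function along a random walk. -/
lemma mean_walk_variance (hν : ν.support.Finite) {f : A → ℝ} (hf : ∀ x y, f (x * y) = f x + f y)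
    (n : ℕ) : mean (walk ν n) (fun x => (f x - n * mean ν f) ^ 2) =
      n * mean ν (fun s => (f s - mean ν f) ^ 2) := by
  induction n with
  | zero =>
    have h1 : f 1 = 0 := by simpa using hf 1 1
    simp [walk, mean_pure, h1]
  | succ n ih =>
    rw [mean_walk_succ hν]
    have : ∀ x, mean ν (fun s => (f (x * s) - (n + 1 : ℕ) * mean ν f) ^ 2) =
        (f x - n * mean ν f) ^ 2 + mean ν (fun s => (f s - mean ν f) ^ 2) := by
      intro x
      have e : (fun s => (f (x * s) - (n + 1 : ℕ) * mean ν f) ^ 2) = fun s =>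
          (f x - n * mean ν f) ^ 2 + ((2 * (f x - n * mean ν f)) * (f s - mean ν f) +
            (f s - mean ν f) ^ 2) := by
        ext s
        rw [hf]
        push_cast
        ring
      rw [e, mean_add hν, mean_add hν, mean_const hν, mean_const_mul, mean_sub hν, mean_const hν]
      ring
    simp only [this]
    rw [mean_add (finite_support_walk hν n), ih, mean_const (finite_support_walk hν n)]
    push_cast
    ring

end Walk

/-! ### The noised step and the joint walk on `G × G` -/

section NoisyStep

variable {G : Type*} {μ : PMF G}

lemma noisyStep_map_fst (μ : PMF G) (ρ : unitInterval) : (noisyStep μ ρ).map Prod.fst = μ := by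
  simp only [noisyStep, PMF.map_bind, PMF.pure_map, PMF.bind_const, PMF.bind_pure]

lemma coin_apply (ρ : unitInterval) (b : Bool) :
    coin ρ b = if b then ENNReal.ofReal (ρ : ℝ) else ENNReal.ofReal (1 - (ρ : ℝ)) := rfl

/-- Given the coin, the second coordinate is one of two samples of law `μ`; the binds are permuted
so that the coin is drawn first. -/
lemma noisyStep_map_snd (μ : PMF G) (ρ : unitInterval) : (noisyStep μ ρ).map Prod.snd = μ := by
  have h : (noisyStep μ ρ).map Prod.snd =
      (coin ρ).bind fun r => μ.bind fun s => μ.bind fun s' => PMF.pure (if r then s' else s) := by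
    simp only [noisyStep, PMF.map_bind, PMF.pure_map]
    rw [PMF.bind_comm]
    conv_rhs => rw [PMF.bind_comm]
    rw [PMF.bind_comm]
    congr 1
    ext1 s
    exact PMF.bind_comm _ _ _
  have h' : ∀ r : Bool, (μ.bind fun s => μ.bind fun s' =>
      PMF.pure (if r then s' else s)) = μ := by
    intro r
    cases r <;> simp
  rw [h]
  simp only [h', PMF.bind_const]

lemma finite_support_noisyStep (hμ : μ.support.Finite) (ρ : unitInterval) :
    (noisyStep μ ρ).support.Finite :=
  finite_support_bind hμ fun _ _ => finite_support_bind hμ fun _ _ =>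
    finite_support_bind (Set.toFinite _) fun _ _ => finite_support_pure _

lemma mean_coin (ρ : unitInterval) (f : Bool → ℝ) :
    mean (coin ρ) f = ρ * f true + (1 - ρ) * f false := by
  rw [mean_eq_sum Finset.univ (fun _ _ => by simp), Fintype.sum_bool, coin_apply, coin_apply, if_pos rfl,
    if_neg Bool.false_ne_true, ENNReal.toReal_ofReal ρ.2.1,
    ENNReal.toReal_ofReal (sub_nonneg.2 ρ.2.2)]

lemma mean_noisyStep (hμ : μ.support.Finite) (ρ : unitInterval) (f : G × G → ℝ) :
    mean (noisyStep μ ρ) f = ρ * mean μ (fun s => mean μ fun s' => f (s, s')) +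
      (1 - ρ) * mean μ (fun s => f (s, s)) := by
  rw [noisyStep, mean_bind hμ fun _ _ => finite_support_bind hμ fun _ _ =>
    finite_support_bind (Set.toFinite _) fun _ _ => finite_support_pure _,
    ← mean_const_mul, ← mean_const_mul, ← mean_add hμ]
  congr 1
  ext s
  rw [mean_bind hμ fun _ _ =>
    finite_support_bind (Set.toFinite _) fun _ _ => finite_support_pure _]
  have : ∀ s', mean ((coin ρ).bind fun r => PMF.pure (s, if r then s' else s)) f =
      ρ * f (s, s') + (1 - ρ) * f (s, s) := by
    intro s'
    rw [mean_bind (Set.toFinite _) fun _ _ => finite_support_pure _, mean_coin]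
    simp [mean_pure]
  simp only [this]
  rw [mean_add hμ, mean_const_mul, mean_const hμ]

/-- Positive noise makes the support of the joint step a full product. This doubles the rank of the
group of differences. -/
lemma noisyStep_ne_zero {ρ : unitInterval} (hρ : 0 < ρ) {s s' : G} (hs : s ∈ μ.support)
    (hs' : s' ∈ μ.support) : (s, s') ∈ (noisyStep μ ρ).support := by
  simp only [noisyStep, PMF.mem_support_bind_iff]
  refine ⟨s, hs, s', hs', true, ?_, by simp⟩
  rw [PMF.mem_support_iff, coin_apply, if_pos rfl]
  simpa using hρ

variable [Group G]

lemma noisyLaw_map_fst (μ : PMF G) (ρ : unitInterval) (n : ℕ) :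
    (noisyLaw μ ρ n).map Prod.fst = walk μ n := by
  have := walk_map (ν := noisyStep μ ρ) (MonoidHom.fst G G) n
  rw [MonoidHom.coe_fst, noisyStep_map_fst] at this
  exact this

lemma noisyLaw_map_snd (μ : PMF G) (ρ : unitInterval) (n : ℕ) :
    (noisyLaw μ ρ n).map Prod.snd = walk μ n := by
  have := walk_map (ν := noisyStep μ ρ) (MonoidHom.snd G G) n
  rw [MonoidHom.coe_snd, noisyStep_map_snd] at this
  exact this

lemma finite_support_noisyLaw (hμ : μ.support.Finite) (ρ : unitInterval) (n : ℕ) :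
    (noisyLaw μ ρ n).support.Finite :=
  finite_support_walk (finite_support_noisyStep hμ ρ) n

/-- The second moment of the displacement of an additive function under noise. -/
lemma mean_noisyLaw_sq (hμ : μ.support.Finite) (ρ : unitInterval) {f : G → ℝ}
    (hf : ∀ x y, f (x * y) = f x + f y) (n : ℕ) :
    mean (noisyLaw μ ρ n) (fun p => (f p.2 - f p.1) ^ 2) =
      n * (ρ * mean μ fun s => mean μ fun s' => (f s' - f s) ^ 2) := by
  have hν := finite_support_noisyStep hμ ρ
  -- Both coordinates of a noised step have the same mean, so the displacement has no drift and its
  -- second moment is its variance.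
  have h0 : mean (noisyStep μ ρ) (fun p => f p.2 - f p.1) = 0 := by
    rw [mean_noisyStep hμ]
    have : ∀ s, mean μ (fun s' => f s' - f s) = mean μ f - f s := fun s => by
      rw [mean_sub hμ, mean_const hμ]
    simp only [this]
    rw [mean_sub hμ, mean_const hμ]
    simp [mean_const hμ]
  have := mean_walk_variance hν (f := fun p => f p.2 - f p.1)
    (fun x y => by simp only [Prod.fst_mul, Prod.snd_mul, hf]; ring) n
  rw [h0] at this
  simp only [mul_zero, sub_zero] at this
  rw [noisyLaw, this, mean_noisyStep hμ]
  simp [mean_const hμ]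

end NoisyStep

/-! ### Shannon entropy: Gibbs' inequality, chain rule, conditioning -/

section Entropy

variable {E F : Type*} {ξ : PMF E}

lemma apply_eq_zero_of_notMem {S : Finset E} (hS : ξ.support ⊆ S) {x : E} (hx : x ∉ S) :
    ξ x = 0 := by
  by_contra h
  exact hx (hS ((PMF.mem_support_iff _ _).2 h))

lemma entropy_eq_sum (S : Finset E) (hS : ξ.support ⊆ S) :
    entropy ξ = ∑ x ∈ S, Real.negMulLog (ξ x).toReal :=
  tsum_eq_sum fun x hx => by simp [apply_eq_zero_of_notMem hS hx]

/-- Gibbs' inequality for an unnormalised comparison weight. -/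
lemma entropy_le_mean_neg_log_add (hξ : ξ.support.Finite) {q : E → ℝ}
    (hq : ∀ x ∈ ξ.support, 0 < q x) {Q : ℝ} (hQ : 0 < Q) (hsum : ∑ x ∈ hξ.toFinset, q x ≤ Q) :
    entropy ξ ≤ mean ξ (fun x => -Real.log (q x)) + Real.log Q := by
  have hS : ξ.support ⊆ hξ.toFinset := by simp
  have key : ∀ x ∈ hξ.toFinset, Real.negMulLog (ξ x).toReal ≤
      (ξ x).toReal * (-Real.log (q x)) + (ξ x).toReal * Real.log Q + (q x / Q - (ξ x).toReal) := by
    intro x hx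
    have hx' : x ∈ ξ.support := by simpa using hx
    have hp : 0 < (ξ x).toReal :=
      ENNReal.toReal_pos ((PMF.mem_support_iff _ _).1 hx') (ξ.apply_ne_top x)
    set p := (ξ x).toReal
    have hqx := hq x hx'
    -- The inequality `log u ≤ u - 1` at `u = q x / (Q p)`, then multiplied by `p`.
    have h := Real.log_le_sub_one_of_pos (div_pos (div_pos hqx hQ) hp)
    rw [Real.log_div (div_pos hqx hQ).ne' hp.ne', Real.log_div hqx.ne' hQ.ne'] at h
    have h2 := mul_le_mul_of_nonneg_left h hp.le
    have h3 : p * (q x / Q / p - 1) = q x / Q - p := by field_simp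
    rw [h3] at h2
    rw [Real.negMulLog]
    linarith
  rw [entropy_eq_sum _ hS]
  refine (Finset.sum_le_sum key).trans ?_
  rw [Finset.sum_add_distrib, Finset.sum_add_distrib, Finset.sum_sub_distrib, ← Finset.sum_mul,
    sum_toReal_eq_one _ hS, one_mul, ← mean_eq_sum _ hS, ← Finset.sum_div]
  have : (∑ x ∈ hξ.toFinset, q x) / Q ≤ 1 := (div_le_one hQ).2 hsum
  linarith

/-- Entropy dominates min-entropy. This turns a uniform bound on atoms into an entropy lower bound.
-/
lemma neg_log_le_entropy (hξ : ξ.support.Finite) {c : ℝ} (hc : ∀ x, (ξ x).toReal ≤ c) :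
    -Real.log c ≤ entropy ξ := by
  have hS : ξ.support ⊆ hξ.toFinset := by simp
  rw [entropy_eq_sum _ hS]
  have : -Real.log c = ∑ x ∈ hξ.toFinset, (ξ x).toReal * (-Real.log c) := by
    rw [← Finset.sum_mul, sum_toReal_eq_one _ hS, one_mul]
  rw [this]
  refine Finset.sum_le_sum fun x hx => ?_
  have hp : 0 < (ξ x).toReal :=
    ENNReal.toReal_pos ((PMF.mem_support_iff _ _).1 (by simpa using hx)) (ξ.apply_ne_top x)
  rw [Real.negMulLog, neg_mul, mul_neg, neg_le_neg_iff]
  exact mul_le_mul_of_nonneg_left (Real.log_le_log hp (hc x)) hp.le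

variable {π : PMF (E × F)}

lemma map_fst_toReal (T : Finset F) (hT : ∀ p ∈ π.support, p.2 ∈ T) (x : E) :
    ((π.map Prod.fst) x).toReal = ∑ y ∈ T, (π (x, y)).toReal := by
  classical
  have h : (π.map Prod.fst) x = ∑ y ∈ T, π (x, y) := by
    rw [PMF.map_apply, ENNReal.tsum_prod', tsum_eq_single x]
    · simp only [if_true]
      refine tsum_eq_sum fun y hy => ?_
      by_contra h
      exact hy (hT (x, y) ((PMF.mem_support_iff _ _).2 h))
    · intro x' hx'
      simp [hx'.symm]
  rw [h, ENNReal.toReal_sum fun y _ => π.apply_ne_top _]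

/-- The chain rule for Shannon entropy. -/
lemma condEntropy_eq (hπ : π.support.Finite) :
    condEntropy π = entropy π - entropy (π.map Prod.fst) := by
  classical
  set S := hπ.toFinset.image Prod.fst
  set T := hπ.toFinset.image Prod.snd
  have hT : ∀ p ∈ π.support, p.2 ∈ T := fun p hp =>
    Finset.mem_image_of_mem _ (by simpa using hp)
  have hS : ∀ p ∈ π.support, p.1 ∈ S := fun p hp =>
    Finset.mem_image_of_mem _ (by simpa using hp)
  have hS' : (π.map Prod.fst).support ⊆ S := by
    rw [PMF.support_map]
    rintro _ ⟨p, hp, rfl⟩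
    exact hS p hp
  have hST : π.support ⊆ (S ×ˢ T : Finset (E × F)) := fun p hp => by
    simpa using ⟨hS p hp, hT p hp⟩
  rw [entropy_eq_sum _ hST, entropy_eq_sum _ hS', Finset.sum_product, ← Finset.sum_sub_distrib,
    condEntropy, tsum_eq_sum (s := S) fun x hx => by simp [apply_eq_zero_of_notMem hS' hx]]
  refine Finset.sum_congr rfl fun x _ => ?_
  have hin : ∑' y, Real.negMulLog ((π (x, y)).toReal / ((π.map Prod.fst) x).toReal) =
      ∑ y ∈ T, Real.negMulLog ((π (x, y)).toReal / ((π.map Prod.fst) x).toReal) := by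
    refine tsum_eq_sum fun y hy => ?_
    have : π (x, y) = 0 := by
      by_contra h
      exact hy (hT (x, y) ((PMF.mem_support_iff _ _).2 h))
    simp [this]
  rw [hin]
  have hp := map_fst_toReal T hT x
  set p := ((π.map Prod.fst) x).toReal
  have hp0 : 0 ≤ p := ENNReal.toReal_nonneg
  rcases hp0.eq_or_lt with h0 | h0
  · rw [← h0] at hp ⊢
    have := (Finset.sum_eq_zero_iff_of_nonneg fun y _ => ENNReal.toReal_nonneg).1 hp.symm
    have hs : ∑ y ∈ T, Real.negMulLog (π (x, y)).toReal = 0 :=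
      Finset.sum_eq_zero fun y hy => by rw [this y hy, Real.negMulLog_zero]
    simp [hs]
  · have hterm : ∀ y, p * Real.negMulLog ((π (x, y)).toReal / p) =
        Real.negMulLog (π (x, y)).toReal + (π (x, y)).toReal * Real.log p := by
      intro y
      rcases eq_or_ne (π (x, y)).toReal 0 with h | h
      · simp [h]
      · rw [Real.negMulLog, Real.negMulLog, Real.log_div h h0.ne']
        field_simp
        ring
    rw [Finset.mul_sum, Finset.sum_congr rfl fun y _ => hterm y, Finset.sum_add_distrib,
      ← Finset.sum_mul, ← hp, Real.negMulLog]
    ring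

/-- Conditioning does not increase entropy. -/
lemma condEntropy_le (hπ : π.support.Finite) :
    condEntropy π ≤ entropy (π.map Prod.snd) := by
  classical
  rw [condEntropy_eq hπ, sub_le_iff_le_add']
  set α := π.map Prod.fst with hα
  set β := π.map Prod.snd with hβ
  have hαf : α.support.Finite := finite_support_map hπ _
  have hβf : β.support.Finite := finite_support_map hπ _
  have hmem : ∀ p ∈ π.support, p.1 ∈ α.support ∧ p.2 ∈ β.support := fun p hp => by
    rw [hα, hβ, PMF.support_map, PMF.support_map]
    exact ⟨⟨p, hp, rfl⟩, ⟨p, hp, rfl⟩⟩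
  have pos : ∀ p ∈ π.support, 0 < (α p.1).toReal ∧ 0 < (β p.2).toReal := fun p hp =>
    ⟨ENNReal.toReal_pos ((PMF.mem_support_iff _ _).1 (hmem p hp).1) (α.apply_ne_top _),
      ENNReal.toReal_pos ((PMF.mem_support_iff _ _).1 (hmem p hp).2) (β.apply_ne_top _)⟩
  -- Gibbs' inequality against the product of the marginals, whose total mass is `1`, is
  -- subadditivity of entropy.
  have h := entropy_le_mean_neg_log_add hπ (q := fun p => (α p.1).toReal * (β p.2).toReal)
    (fun p hp => mul_pos (pos p hp).1 (pos p hp).2) one_pos ?_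
  · rw [Real.log_one, add_zero] at h
    refine h.trans (le_of_eq ?_)
    have e1 : entropy α = mean π (fun p => -Real.log (α p.1).toReal) := by
      rw [entropy_eq_sum hαf.toFinset (by simp)]
      have := mean_map hπ Prod.fst fun x => -Real.log (α x).toReal
      rw [Function.comp_def] at this
      rw [← this, mean_eq_sum hαf.toFinset (by simp [hα])]
      exact Finset.sum_congr rfl fun x _ => by rw [Real.negMulLog, neg_mul, mul_neg]
    have e2 : entropy β = mean π (fun p => -Real.log (β p.2).toReal) := by
      rw [entropy_eq_sum hβf.toFinset (by simp)]
      have := mean_map hπ Prod.snd fun x => -Real.log (β x).toReal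
      rw [Function.comp_def] at this
      rw [← this, mean_eq_sum hβf.toFinset (by simp [hβ])]
      exact Finset.sum_congr rfl fun x _ => by rw [Real.negMulLog, neg_mul, mul_neg]
    rw [e1, e2, ← mean_add hπ]
    refine le_antisymm (mean_mono hπ fun p hp => ?_) (mean_mono hπ fun p hp => ?_) <;>
    · rw [Real.log_mul (pos p hp).1.ne' (pos p hp).2.ne']
      linarith
  · have hsub : hπ.toFinset ⊆ hαf.toFinset ×ˢ hβf.toFinset := fun p hp => by
      simpa using hmem p (by simpa using hp)
    refine (Finset.sum_le_sum_of_subset_of_nonneg hsub fun p _ _ =>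
      mul_nonneg ENNReal.toReal_nonneg ENNReal.toReal_nonneg).trans (le_of_eq ?_)
    have hprod := Finset.sum_mul_sum hαf.toFinset hβf.toFinset (fun x => (α x).toReal)
      fun y => (β y).toReal
    rw [Finset.sum_product, ← hprod, sum_toReal_eq_one _ (by simp),
      sum_toReal_eq_one _ (by simp), one_mul]

end Entropy

/-! ### Binomial estimates -/

section Choose

/-- The ratio of the two sides is monotone in `m`, because `(2m + 3)(2m + 1) ≤ 4(m + 1)²`; this
replaces Stirling's formula. -/
lemma two_mul_add_one_mul_centralBinom_sq_le (m : ℕ) :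
    (2 * m + 1) * m.centralBinom ^ 2 ≤ 16 ^ m := by
  induction m with
  | zero => simp
  | succ m ih =>
    have h := Nat.succ_mul_centralBinom_succ m
    have h2 : (m + 1) ^ 2 * ((2 * (m + 1) + 1) * (m + 1).centralBinom ^ 2) ≤
        (m + 1) ^ 2 * 16 ^ (m + 1) := by
      calc (m + 1) ^ 2 * ((2 * (m + 1) + 1) * (m + 1).centralBinom ^ 2)
          = (2 * m + 3) * ((m + 1) * (m + 1).centralBinom) ^ 2 := by ring
        _ = (4 * ((2 * m + 3) * (2 * m + 1))) * ((2 * m + 1) * m.centralBinom ^ 2) := by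
            rw [h]; ring
        _ ≤ (4 * (4 * (m + 1) ^ 2)) * 16 ^ m := by
            have : (2 * m + 3) * (2 * m + 1) ≤ 4 * (m + 1) ^ 2 := by nlinarith
            exact Nat.mul_le_mul (Nat.mul_le_mul_left _ this) ih
        _ = (m + 1) ^ 2 * 16 ^ (m + 1) := by ring
    exact Nat.le_of_mul_le_mul_left h2 (by positivity)

lemma succ_mul_choose_half_sq_le (k : ℕ) : (k + 1) * k.choose (k / 2) ^ 2 ≤ 4 ^ k := by
  rcases Nat.even_or_odd' k with ⟨m, rfl | rfl⟩
  · have h := two_mul_add_one_mul_centralBinom_sq_le m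
    rw [Nat.mul_div_cancel_left m two_pos, pow_mul]
    simpa [Nat.centralBinom] using h
  · have h := two_mul_add_one_mul_centralBinom_sq_le (m + 1)
    have e : (m + 1).centralBinom = 2 * (2 * m + 1).choose m := by
      rw [Nat.centralBinom, show 2 * (m + 1) = 2 * m + 1 + 1 by ring, Nat.choose_succ_succ,
        Nat.choose_symm_half]
      ring
    rw [e] at h
    have hd : (2 * m + 1) / 2 = m := by omega
    rw [hd]
    have h3 : 4 * ((2 * m + 1 + 1) * (2 * m + 1).choose m ^ 2) ≤ 4 * 4 ^ (2 * m + 1) := by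
      calc 4 * ((2 * m + 1 + 1) * (2 * m + 1).choose m ^ 2)
          ≤ (2 * (m + 1) + 1) * (2 * (2 * m + 1).choose m) ^ 2 := by
            rw [mul_pow]
            nlinarith [Nat.zero_le ((2 * m + 1).choose m ^ 2)]
        _ ≤ 16 ^ (m + 1) := h
        _ = 4 * 4 ^ (2 * m + 1) := by
            rw [show (16 : ℕ) = 4 ^ 2 by norm_num, ← pow_mul]
            ring
    omega

lemma choose_half_le (k : ℕ) : (k.choose (k / 2) : ℝ) ≤ 2 ^ k / √(k + 1) := by
  have hk : (0 : ℝ) < k + 1 := by positivity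
  rw [le_div_iff₀ (Real.sqrt_pos.2 hk)]
  refine le_of_sq_le_sq ?_ (by positivity)
  rw [mul_pow, Real.sq_sqrt hk.le, ← pow_mul, mul_comm k 2, pow_mul]
  have := succ_mul_choose_half_sq_le k
  have h2 : ((k + 1 : ℕ) : ℝ) * (k.choose (k / 2) : ℝ) ^ 2 ≤ 4 ^ k := by exact_mod_cast this
  push_cast at h2
  norm_num
  linarith

/-- The expectation of `(K + 1)⁻¹` for a binomial variable `K`. -/
lemma sum_binomial_div_succ_le {w : ℝ} (hw : 0 < w) (hw1 : w ≤ 1) (n : ℕ) :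
    ∑ k ∈ Finset.range (n + 1), w ^ k * (1 - w) ^ (n - k) * n.choose k / (k + 1) ≤
      1 / ((n + 1) * w) := by
  -- Since `n.choose k / (k + 1) = (n + 1).choose (k + 1) / (n + 1)`, the sum times `(n + 1) w` is
  -- the binomial expansion of `1` at exponent `n + 1` without its term of index `0`.
  have h1 := add_pow w (1 - w) (n + 1)
  rw [add_sub_cancel, one_pow, Finset.sum_range_succ'] at h1
  have hn : (0 : ℝ) < (n + 1) * w := by positivity
  rw [le_div_iff₀ hn, Finset.sum_mul]
  have hlast : 0 ≤ w ^ 0 * (1 - w) ^ (n + 1 - 0) * ((n + 1).choose 0 : ℝ) := by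
    have : 0 ≤ 1 - w := by linarith
    positivity
  refine (Finset.sum_le_sum fun k _ => le_of_eq ?_).trans (by linarith : _ ≤ (1 : ℝ))
  have h2 : ((n + 1 : ℕ) : ℝ) * n.choose k = (n + 1).choose (k + 1) * ((k + 1 : ℕ) : ℝ) := by
    exact_mod_cast Nat.add_one_mul_choose_eq n k
  push_cast at h2
  have hk : (0 : ℝ) < k + 1 := by positivity
  rw [Nat.add_sub_add_right]
  have h3 : ((n + 1).choose (k + 1) : ℝ) = (n + 1) * n.choose k / (k + 1) := by
    rw [h2]; field_simp
  rw [h3]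
  field_simp
  ring

/-- By AM-GM, `1 / r ≤ (t / 2) / r² + 1 / (2t)`. With `r = √(k + 1)` and `t = √((n + 1) w)`, both
terms contribute at most `1 / (2t)` after averaging. -/
lemma sum_binomial_div_sqrt_succ_le {w : ℝ} (hw : 0 < w) (hw1 : w ≤ 1) (n : ℕ) :
    ∑ k ∈ Finset.range (n + 1), w ^ k * (1 - w) ^ (n - k) * n.choose k / √(k + 1) ≤
      1 / √((n + 1) * w) := by
  have hnw : (0 : ℝ) < (n + 1) * w := by positivity
  set t := √((n + 1) * w) with ht
  have ht0 : 0 < t := Real.sqrt_pos.2 hnw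
  have htt : t * t = (n + 1) * w := Real.mul_self_sqrt hnw.le
  have hw' : 0 ≤ 1 - w := by linarith
  have key : ∀ k ∈ Finset.range (n + 1), w ^ k * (1 - w) ^ (n - k) * n.choose k / √(k + 1) ≤
      t / 2 * (w ^ k * (1 - w) ^ (n - k) * n.choose k / (k + 1)) +
        1 / (2 * t) * (w ^ k * (1 - w) ^ (n - k) * n.choose k) := by
    intro k _
    have hk : (0 : ℝ) < k + 1 := by positivity
    set r := √((k : ℝ) + 1)
    have hr0 : 0 < r := Real.sqrt_pos.2 hk
    have hrr : r * r = k + 1 := Real.mul_self_sqrt hk.le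
    rw [← hrr]
    have hp : 0 ≤ w ^ k * (1 - w) ^ (n - k) * n.choose k := by positivity
    set p := w ^ k * (1 - w) ^ (n - k) * (n.choose k : ℝ)
    have h : 1 / r ≤ t / 2 * (1 / (r * r)) + 1 / (2 * t) := by
      rw [← sub_nonneg]
      have : t / 2 * (1 / (r * r)) + 1 / (2 * t) - 1 / r = (t - r) ^ 2 / (2 * t * (r * r)) := by
        field_simp
        ring
      rw [this]
      positivity
    calc p / r = p * (1 / r) := by ring
      _ ≤ p * (t / 2 * (1 / (r * r)) + 1 / (2 * t)) := mul_le_mul_of_nonneg_left h hp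
      _ = _ := by ring
  refine (Finset.sum_le_sum key).trans ?_
  rw [Finset.sum_add_distrib, ← Finset.mul_sum, ← Finset.mul_sum, ← add_pow, add_sub_cancel,
    one_pow]
  have h := mul_le_mul_of_nonneg_left (sum_binomial_div_succ_le hw hw1 n)
    (by positivity : 0 ≤ t / 2)
  rw [← htt] at h
  have e : t / 2 * (1 / (t * t)) + 1 / (2 * t) * 1 = 1 / t := by field_simp; norm_num
  linarith

end Choose

/-! ### Commuting translation operators on nonnegative functions -/

section Operators

variable {A ι κ : Type*} [CommGroup A]

/-- The operator `a ↦ (x ↦ ∑ᵢ rᵢ a(x gᵢ))` on nonnegative functions. -/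
def translates (g : ι → A) (r : ι → ℝ≥0∞) : Module.End ℝ≥0∞ (A → ℝ≥0∞) where
  toFun a x := ∑' i, r i * a (x * g i)
  map_add' a b := by
    ext x
    simp [mul_add, ENNReal.tsum_add]
  map_smul' c a := by
    ext x
    simp [← ENNReal.tsum_mul_left, mul_left_comm]

lemma translates_apply (g : ι → A) (r : ι → ℝ≥0∞) (a : A → ℝ≥0∞) (x : A) :
    translates g r a x = ∑' i, r i * a (x * g i) := rfl

/-- Commutativity of `A` enters here. It permits the binomial theorem for sums of these operators
and lets orbit sums pass through convolutions. -/
lemma translates_commute (g : ι → A) (r : ι → ℝ≥0∞) (g' : κ → A) (r' : κ → ℝ≥0∞) :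
    Commute (translates g r) (translates g' r') := by
  refine LinearMap.ext fun a => funext fun x => ?_
  simp only [Module.End.mul_apply, translates_apply, ← ENNReal.tsum_mul_left]
  rw [ENNReal.tsum_comm]
  refine tsum_congr fun i => tsum_congr fun j => ?_
  rw [mul_left_comm, mul_right_comm x]

lemma translates_le (g : ι → A) (r : ι → ℝ≥0∞) {a : A → ℝ≥0∞} {M : ℝ≥0∞} (h : ∀ x, a x ≤ M)
    (x : A) : translates g r a x ≤ (∑' i, r i) * M := by
  rw [translates_apply, ← ENNReal.tsum_mul_right]
  exact ENNReal.tsum_le_tsum fun i => mul_le_mul_right (h _) _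

lemma translates_pow_le (g : ι → A) (r : ι → ℝ≥0∞) {a : A → ℝ≥0∞} {M : ℝ≥0∞} (h : ∀ x, a x ≤ M)
    (n : ℕ) (x : A) : (translates g r ^ n) a x ≤ (∑' i, r i) ^ n * M := by
  induction n generalizing x with
  | zero => simpa using h x
  | succ n ih =>
    rw [pow_succ', Module.End.mul_apply, pow_succ', mul_assoc]
    exact translates_le g r ih x

/-- Summation along the orbits of multiplication by `h`. -/
def orbitSum (h : A) : Module.End ℝ≥0∞ (A → ℝ≥0∞) :=
  translates (fun j : ℤ => h ^ j) fun _ => 1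

lemma orbitSum_apply (h : A) (a : A → ℝ≥0∞) (x : A) :
    orbitSum h a x = ∑' j : ℤ, a (x * h ^ j) := by
  simp [orbitSum, translates_apply]

/-- Translation by `g⁻¹`. -/
def shift (g : A) : Module.End ℝ≥0∞ (A → ℝ≥0∞) :=
  translates (fun _ : Unit => g⁻¹) fun _ => 1

lemma shift_apply (g : A) (a : A → ℝ≥0∞) (x : A) : shift g a x = a (x * g⁻¹) := by
  simp [shift, translates_apply]

lemma shift_pow_apply (g : A) (n : ℕ) (a : A → ℝ≥0∞) (x : A) :
    (shift g ^ n) a x = a (x * g⁻¹ ^ n) := by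
  induction n generalizing x with
  | zero => simp
  | succ n ih =>
    rw [pow_succ', Module.End.mul_apply, shift_apply, ih, pow_succ', mul_assoc]

/-- The convolution operator of a step law. -/
def convOp (ν : PMF A) : Module.End ℝ≥0∞ (A → ℝ≥0∞) :=
  translates (fun s : A => s⁻¹) ν

lemma tsum_bind_mul {E F : Type*} (ξ : PMF E) (κ : E → PMF F) (f : F → ℝ≥0∞) :
    ∑' y, (ξ.bind κ) y * f y = ∑' x, ξ x * ∑' y, κ x y * f y := by
  simp only [PMF.bind_apply, ← ENNReal.tsum_mul_right, ← ENNReal.tsum_mul_left]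
  rw [ENNReal.tsum_comm]
  simp only [mul_assoc]

lemma tsum_pure_mul {E : Type*} (x : E) (f : E → ℝ≥0∞) :
    ∑' y, (PMF.pure x) y * f y = f x := by
  rw [tsum_eq_single x fun y hy => by simp [hy]]
  simp

lemma convOp_pow_apply (ν : PMF A) (n : ℕ) (a : A → ℝ≥0∞) (x : A) :
    (convOp ν ^ n) a x = ∑' y, walk ν n y * a (x * y⁻¹) := by
  induction n generalizing a with
  | zero => simp [walk]
  | succ n ih =>
    rw [pow_succ, Module.End.mul_apply, ih, walk, tsum_bind_mul]
    refine tsum_congr fun y => ?_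
    rw [tsum_bind_mul]
    simp only [tsum_pure_mul, convOp, translates_apply, mul_inv, mul_assoc]

/-- A sum of two shifts spreads mass along orbits at a binomial rate. -/
lemma shift_add_shift_pow_le (s t : A) (b : A → ℝ≥0∞) {M : ℝ≥0∞}
    (hM : ∀ x, orbitSum (t * s⁻¹) b x ≤ M) (k : ℕ) (x : A) :
    ((shift s + shift t) ^ k) b x ≤ (k.choose (k / 2) : ℝ≥0∞) * M := by
  have hc : Commute (shift s) (shift t) := translates_commute _ _ _ _
  rw [hc.add_pow, LinearMap.sum_apply, Finset.sum_apply]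
  -- The `j`-th binomial term evaluates `b` at a point of one orbit of `t * s⁻¹`. Distinct `j` give
  -- distinct exponents, so once the coefficients are bounded by the central one, the rest is part
  -- of an orbit sum.
  have term : ∀ j ∈ Finset.range (k + 1),
      (shift s ^ j * shift t ^ (k - j) * ((k.choose j : ℕ) : Module.End ℝ≥0∞ (A → ℝ≥0∞))) b x ≤
        (k.choose (k / 2) : ℝ≥0∞) * b (x * (s⁻¹) ^ k * (t * s⁻¹) ^ ((j : ℤ) - k)) := by
    intro j hj
    have hj' : j ≤ k := Nat.lt_succ_iff.1 (Finset.mem_range.1 hj)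
    obtain ⟨l, rfl⟩ := Nat.exists_eq_add_of_le hj'
    rw [← nsmul_eq_mul', LinearMap.smul_apply, Pi.smul_apply, nsmul_eq_mul, Module.End.mul_apply,
      shift_pow_apply, shift_pow_apply]
    have e : x * s⁻¹ ^ j * t⁻¹ ^ (j + l - j) =
        x * (s⁻¹) ^ (j + l) * (t * s⁻¹) ^ ((j : ℤ) - (j + l : ℕ)) := by
      have : (j : ℤ) - (j + l : ℕ) = -(l : ℤ) := by push_cast; ring
      rw [this, zpow_neg, zpow_natCast, Nat.add_sub_cancel_left, pow_add, mul_pow, mul_inv]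
      simp only [inv_pow, inv_inv, mul_assoc]
      rw [mul_comm (t ^ l)⁻¹, inv_mul_cancel_left]
    rw [e]
    gcongr
    exact Nat.choose_le_middle _ _
  refine (Finset.sum_le_sum term).trans ?_
  rw [← Finset.mul_sum]
  refine mul_le_mul_right (le_trans ?_ (hM (x * (s⁻¹) ^ k))) _
  rw [orbitSum_apply]
  have hinj : Function.Injective fun j : ℕ => (j : ℤ) - k := fun i j h => by
    simpa using h
  have := ENNReal.sum_le_tsum (f := fun j : ℤ => b (x * (s⁻¹) ^ k * (t * s⁻¹) ^ j))
    ((Finset.range (k + 1)).map ⟨_, hinj⟩)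
  simpa only [Finset.sum_map, Function.Embedding.coeFn_mk] using this

end Operators

/-! ### Anticoncentration of walks on abelian groups -/

section Anticoncentration

variable {A : Type*} [CommGroup A] {ν : PMF A}

/-- Removing the common mass `min (ν s) (ν t)` from both atoms writes `ν` as a mixture: with weight
`w`, equal to twice that mass, a fair choice between `s` and `t`, and otherwise a remainder. -/
lemma exists_convOp_eq {s t : A} (hs : s ∈ ν.support) (ht : t ∈ ν.support) (hst : s ≠ t) :
    ∃ (w : ℝ) (r : A → ℝ≥0∞), 0 < w ∧ w ≤ 1 ∧ ∑' y, r y = ENNReal.ofReal (1 - w) ∧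
      convOp ν = ENNReal.ofReal (w / 2) • (shift s + shift t) +
        translates (fun y : A => y⁻¹) r := by
  classical
  set c := min (ν s) (ν t) with hc
  have hc0 : c ≠ 0 := (lt_min (pos_iff_ne_zero.2 hs) (pos_iff_ne_zero.2 ht)).ne'
  have hctop : c ≠ ∞ := ((min_le_left _ _).trans_lt (ν.apply_lt_top s)).ne
  set r : A → ℝ≥0∞ := fun y => if y = s ∨ y = t then ν y - c else ν y with hr
  have dec : ∀ y, ν y = (if y = s then c else 0) + (if y = t then c else 0) + r y := by
    intro y
    rcases eq_or_ne y s with rfl | hys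
    · have h : ν y = c + (ν y - c) := (add_tsub_cancel_of_le (min_le_left _ _)).symm
      simpa only [hr, if_true, if_neg hst, true_or, add_zero] using h
    · rcases eq_or_ne y t with rfl | hyt
      · have h : ν y = c + (ν y - c) := (add_tsub_cancel_of_le (min_le_right _ _)).symm
        simpa only [hr, if_true, if_neg hys, or_true, zero_add] using h
      · simp [hr, hys, hyt]
  have hsum : 1 = c + c + ∑' y, r y := by
    rw [← ν.tsum_coe, tsum_congr dec, ENNReal.tsum_add, ENNReal.tsum_add, tsum_ite_eq,
      tsum_ite_eq]
  have hcc : c + c = ENNReal.ofReal (2 * c.toReal) := by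
    rw [two_mul, ENNReal.ofReal_add ENNReal.toReal_nonneg ENNReal.toReal_nonneg,
      ENNReal.ofReal_toReal hctop]
  refine ⟨2 * c.toReal, r, mul_pos two_pos (ENNReal.toReal_pos hc0 hctop), ?_, ?_, ?_⟩
  · have : c + c ≤ 1 := hsum ▸ le_self_add
    rwa [hcc, ENNReal.ofReal_le_one] at this
  · rw [ENNReal.ofReal_sub _ (by positivity), ← hcc, ENNReal.ofReal_one, hsum]
    exact (ENNReal.add_sub_cancel_left (ENNReal.add_ne_top.2 ⟨hctop, hctop⟩)).symm
  · refine LinearMap.ext fun a => funext fun x => ?_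
    rw [mul_div_cancel_left₀ _ two_ne_zero, ENNReal.ofReal_toReal hctop, LinearMap.add_apply,
      LinearMap.smul_apply, LinearMap.add_apply, Pi.add_apply, Pi.smul_apply, Pi.add_apply,
      shift_apply, shift_apply, convOp, translates_apply, translates_apply,
      tsum_congr fun y => by rw [dec y, add_mul, add_mul], ENNReal.tsum_add, ENNReal.tsum_add,
      smul_eq_mul, mul_add]
    congr 2
    · rw [tsum_eq_single s fun y hy => by simp [hy]]
      simp
    · rw [tsum_eq_single t fun y hy => by simp [hy]]
      simp

/-- A walk whose step law charges `s` and `t` spreads out along the direction `t s⁻¹`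
at rate `n ^ (-1/2)`. -/
lemma exists_convOp_pow_le {s t : A} (hs : s ∈ ν.support) (ht : t ∈ ν.support) (hst : s ≠ t) :
    ∃ K : ℝ, 0 < K ∧ ∀ (n : ℕ) (a : A → ℝ≥0∞) (M : ℝ≥0∞),
      (∀ x, orbitSum (t * s⁻¹) a x ≤ M) →
        ∀ x, (convOp ν ^ n) a x ≤ ENNReal.ofReal (K / √(n + 1)) * M := by
  obtain ⟨w, r, hw, hw1, hr, hdec⟩ := exists_convOp_eq hs ht hst
  refine ⟨1 / √w, by positivity, fun n a M hM x => ?_⟩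
  set R := translates (fun y : A => y⁻¹) r with hR
  have hw' : 0 ≤ 1 - w := by linarith
  have hcomm : Commute (ENNReal.ofReal (w / 2) • (shift s + shift t)) R :=
    ((translates_commute _ _ _ _).add_left (translates_commute _ _ _ _)).smul_left _
  rw [hdec, hcomm.add_pow, LinearMap.sum_apply, Finset.sum_apply]
  -- Here `k` counts the steps made by the fair choice. They cost `k.choose (k / 2) / 2 ^ k ≤ 1 /
  -- √(k + 1)`; the remaining `n - k` steps commute with the orbit sum and contribute their mass.
  -- Averaging over the binomial `k` gives the rate.
  have term : ∀ k ∈ Finset.range (n + 1),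
      ((ENNReal.ofReal (w / 2) • (shift s + shift t)) ^ k * R ^ (n - k) *
        ((n.choose k : ℕ) : Module.End ℝ≥0∞ (A → ℝ≥0∞))) a x ≤
        ENNReal.ofReal (w ^ k * (1 - w) ^ (n - k) * n.choose k / √(k + 1)) * M := by
    intro k _
    rw [← nsmul_eq_mul', LinearMap.smul_apply, Pi.smul_apply, nsmul_eq_mul, smul_pow,
      smul_mul_assoc, LinearMap.smul_apply, Pi.smul_apply, smul_eq_mul, Module.End.mul_apply]
    have h1 : ∀ x, orbitSum (t * s⁻¹) ((R ^ (n - k)) a) x ≤ ENNReal.ofReal (1 - w) ^ (n - k) * M := by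
      intro x
      have hc : Commute (orbitSum (t * s⁻¹)) (R ^ (n - k)) :=
        (translates_commute _ _ _ _ : Commute (orbitSum (t * s⁻¹)) R).pow_right _
      rw [← Module.End.mul_apply, hc.eq, Module.End.mul_apply, ← hr]
      exact translates_pow_le _ _ hM _ _
    calc (n.choose k : ℝ≥0∞) * (ENNReal.ofReal (w / 2) ^ k *
          ((shift s + shift t) ^ k) ((R ^ (n - k)) a) x)
        ≤ (n.choose k : ℝ≥0∞) * (ENNReal.ofReal (w / 2) ^ k *
          ((k.choose (k / 2) : ℝ≥0∞) * (ENNReal.ofReal (1 - w) ^ (n - k) * M))) := by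
          gcongr
          exact shift_add_shift_pow_le s t _ h1 k x
      _ = ENNReal.ofReal (n.choose k * ((w / 2) ^ k * (k.choose (k / 2) * (1 - w) ^ (n - k)))) *
          M := by
          rw [ENNReal.ofReal_mul (by positivity), ENNReal.ofReal_mul (by positivity),
            ENNReal.ofReal_mul (by positivity), ENNReal.ofReal_pow (by positivity),
            ENNReal.ofReal_pow hw', ENNReal.ofReal_natCast, ENNReal.ofReal_natCast]
          ring
      _ ≤ _ := by
          gcongr ENNReal.ofReal ?_ * M
          calc (n.choose k : ℝ) * ((w / 2) ^ k * (k.choose (k / 2) * (1 - w) ^ (n - k)))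
              ≤ (n.choose k : ℝ) * ((w / 2) ^ k * (2 ^ k / √(k + 1) * (1 - w) ^ (n - k))) := by
                gcongr
                exact choose_half_le k
            _ = _ := by
                rw [div_pow]
                field_simp
  refine (Finset.sum_le_sum term).trans ?_
  rw [← Finset.sum_mul, ← ENNReal.ofReal_sum_of_nonneg fun k _ => by positivity]
  gcongr
  refine (sum_binomial_div_sqrt_succ_le hw hw1 n).trans (le_of_eq ?_)
  rw [Real.sqrt_mul (by positivity)]
  field_simp

/-- One block of `n` steps is spent on each direction `h`, gaining a factor of order `1 / √(n + 1)`.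
The blocks can be treated one by one because orbit sums commute with convolution. -/
lemma exists_convOp_pow_mul_length_le (l : List A)
    (hl : ∀ h ∈ l, ∃ s ∈ ν.support, ∃ t ∈ ν.support, s ≠ t ∧ h = t * s⁻¹) :
    ∃ K : ℝ, 0 < K ∧ ∀ (n : ℕ) (a : A → ℝ≥0∞) (M : ℝ≥0∞),
      (∀ x, (l.map orbitSum).prod a x ≤ M) →
        ∀ x, (convOp ν ^ (n * l.length)) a x ≤ ENNReal.ofReal (K / √(n + 1) ^ l.length) * M := by
  induction l with
  | nil => exact ⟨1, one_pos, fun n a M hM x => by simpa using hM x⟩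
  | cons h l ih =>
    obtain ⟨K, hK, hKb⟩ := ih fun h' hh' => hl h' (List.mem_cons_of_mem _ hh')
    obtain ⟨s, hs, t, ht, hst, rfl⟩ := hl h List.mem_cons_self
    obtain ⟨K', hK', hKb'⟩ := exists_convOp_pow_le hs ht hst
    refine ⟨K * K', by positivity, fun n a M hM x => ?_⟩
    have h1 : ∀ x, (l.map orbitSum).prod ((convOp ν ^ n) a) x ≤
        ENNReal.ofReal (K' / √(n + 1)) * M := by
      intro x
      have hc : Commute (l.map orbitSum).prod (convOp ν ^ n) := by
        refine (Commute.list_prod_left _ _ fun T hT => ?_).pow_right _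
        obtain ⟨h', -, rfl⟩ := List.mem_map.1 hT
        exact translates_commute _ _ _ _
      rw [← Module.End.mul_apply, hc.eq, Module.End.mul_apply]
      refine hKb' n _ M (fun y => ?_) x
      simpa [Module.End.mul_apply] using hM y
    have h2 := hKb n _ _ h1 x
    rw [← Module.End.mul_apply, ← pow_add] at h2
    rw [List.length_cons, mul_add, mul_one]
    refine h2.trans (le_of_eq ?_)
    rw [← mul_assoc, ← ENNReal.ofReal_mul (by positivity)]
    congr 2
    rw [div_mul_div_comm, pow_succ]

lemma convOp_pow_le {a : A → ℝ≥0∞} {M : ℝ≥0∞} (h : ∀ x, a x ≤ M) (n : ℕ) (x : A) :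
    (convOp ν ^ n) a x ≤ M := by
  have := translates_pow_le (fun s : A => s⁻¹) ν h n x
  rwa [ν.tsum_coe, one_pow, one_mul] at this

/-- A general time is split into `l.length` equal blocks and a remainder. The remainder does no
harm, since convolution preserves uniform upper bounds. -/
lemma exists_convOp_pow_le_of_list {l : List A} (hne : l ≠ [])
    (hl : ∀ h ∈ l, ∃ s ∈ ν.support, ∃ t ∈ ν.support, s ≠ t ∧ h = t * s⁻¹) :
    ∃ K : ℝ, 0 < K ∧ ∀ (N : ℕ) (a : A → ℝ≥0∞),
      (∀ x, (l.map orbitSum).prod a x ≤ 1) →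
        ∀ x, (convOp ν ^ N) a x ≤ ENNReal.ofReal (K / √(N + 1) ^ l.length) := by
  obtain ⟨K, hK, hKb⟩ := exists_convOp_pow_mul_length_le l hl
  have hlen : 0 < l.length := List.length_pos_iff.2 hne
  have hlen' : (0 : ℝ) < l.length := by exact_mod_cast hlen
  refine ⟨K * √l.length ^ l.length, by positivity, fun N a ha x => ?_⟩
  have h1 := hKb (N / l.length) a 1 ha
  have h2 := convOp_pow_le (ν := ν) h1 (N % l.length) x
  rw [← Module.End.mul_apply, ← pow_add, mul_comm (N / l.length), Nat.mod_add_div, mul_one] at h2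
  refine h2.trans (ENNReal.ofReal_le_ofReal ?_)
  rw [div_le_div_iff₀ (by positivity) (by positivity), mul_assoc, ← mul_pow,
    ← Real.sqrt_mul hlen'.le]
  gcongr
  have : N + 1 ≤ l.length * (N / l.length + 1) := by
    have := Nat.lt_mul_div_succ N hlen
    omega
  exact_mod_cast this

/-- Along an orbit of `h` the homomorphism `f` is injective, so the orbit meets the fibre carrying
`b` at most once. -/
lemma orbitSum_le_one {f : A →* Multiplicative ℤ} {h : A} (hf : f h ≠ 1) {b : A → ℝ≥0∞}
    (hb : ∀ y, b y ≤ 1) {k : Multiplicative ℤ} (hk : ∀ y, b y ≠ 0 → f y = k) (x : A) :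
    orbitSum h b x ≤ 1 := by
  rw [orbitSum_apply]
  by_cases hex : ∃ j : ℤ, b (x * h ^ j) ≠ 0
  · obtain ⟨j, hj⟩ := hex
    rw [tsum_eq_single j]
    · exact hb _
    · intro i hi
      by_contra h0
      have e := (hk _ hj).trans (hk _ h0).symm
      rw [map_mul, map_mul, mul_right_inj, map_zpow, map_zpow] at e
      have e2 := congrArg Multiplicative.toAdd e
      rw [toAdd_zpow, toAdd_zpow, smul_eq_mul, smul_eq_mul] at e2
      exact hi (mul_right_cancel₀ (fun h => hf (toAdd_eq_zero.1 h)) e2).symm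
  · push Not at hex
    simp [hex]

/-- Moving along `h i` is invisible to `f j` for `j ≠ i`. Hence, before the sum along `h i` is
taken, the function is still carried by the kernel of `f i`, and `orbitSum_le_one` applies. -/
lemma list_orbitSum_le_one {ι : Type*} {h : ι → A} {f : ι → A →* Multiplicative ℤ}
    (hf : ∀ i, f i (h i) ≠ 1) (hf' : ∀ i j, i ≠ j → f i (h j) = 1) {b : A → ℝ≥0∞}
    (hb : ∀ y, b y ≤ 1) (hb' : ∀ y, b y ≠ 0 → y = 1) (l : List ι) (hl : l.Nodup) :
    (∀ x, ((l.map h).map orbitSum).prod b x ≤ 1) ∧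
      ∀ x, ((l.map h).map orbitSum).prod b x ≠ 0 → ∀ i ∉ l, f i x = 1 := by
  induction l with
  | nil =>
    refine ⟨fun x => by simpa using hb x, fun x hx i _ => ?_⟩
    rw [hb' x (by simpa using hx), map_one]
  | cons i l ih =>
    rw [List.nodup_cons] at hl
    obtain ⟨h1, h2⟩ := ih hl.2
    simp only [List.map_cons, List.prod_cons, Module.End.mul_apply]
    refine ⟨orbitSum_le_one (hf i) h1 fun y hy => h2 y hy i hl.1, fun x hx i' hi' => ?_⟩
    rw [orbitSum_apply] at hx
    obtain ⟨j, hj⟩ : ∃ j : ℤ, (List.map orbitSum (List.map h l)).prod b (x * h i ^ j) ≠ 0 := by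
      by_contra hcon
      push Not at hcon
      exact hx (ENNReal.tsum_eq_zero.2 hcon)
    rw [List.mem_cons, not_or] at hi'
    have := h2 _ hj i' hi'.2
    rwa [map_mul, map_zpow, hf' i' i hi'.1, one_zpow, mul_one] at this

/-- Anticoncentration of a random walk whose step law has differences spanning a free abelian
group of rank `Fintype.card ι`. -/
lemma exists_walk_le {ι : Type*} [Fintype ι] [Nonempty ι] {h : ι → A}
    {f : ι → A →* Multiplicative ℤ} (hf : ∀ i, f i (h i) ≠ 1)
    (hf' : ∀ i j, i ≠ j → f i (h j) = 1)
    (hh : ∀ i, ∃ s ∈ ν.support, ∃ t ∈ ν.support, h i = t * s⁻¹) :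
    ∃ K : ℝ, 0 < K ∧ ∀ (n : ℕ) (x : A),
      (walk ν n x).toReal ≤ K / √(n + 1) ^ Fintype.card ι := by
  classical
  set l := (Finset.univ : Finset ι).toList
  have hl : ∀ g ∈ l.map h, ∃ s ∈ ν.support, ∃ t ∈ ν.support, s ≠ t ∧ g = t * s⁻¹ := by
    intro g hg
    obtain ⟨i, -, rfl⟩ := List.mem_map.1 hg
    obtain ⟨s, hs, t, ht, e⟩ := hh i
    refine ⟨s, hs, t, ht, ?_, e⟩
    rintro rfl
    exact hf i (by rw [e, mul_inv_cancel, map_one])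
  have hne : l.map h ≠ [] := by simp [l, Finset.univ_nonempty.ne_empty]
  obtain ⟨K, hK, hKb⟩ := exists_convOp_pow_le_of_list hne hl
  refine ⟨K, hK, fun n x => ?_⟩
  -- The test function is the point mass at `1`; its convolution with the law of the walk is that
  -- law.
  have hδ := (list_orbitSum_le_one hf hf' (b := fun y => if y = 1 then 1 else 0)
    (fun y => by split_ifs <;> simp) (fun y hy => by simpa using hy) l
    (Finset.nodup_toList _)).1
  have := hKb n _ hδ x
  rw [convOp_pow_apply, tsum_eq_single x] at this
  · simp only [mul_inv_cancel, if_true, mul_one, List.length_map, l, Finset.length_toList,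
      Finset.card_univ] at this
    exact ENNReal.toReal_le_of_le_ofReal (by positivity) this
  · intro y hy
    rw [if_neg, mul_zero]
    rw [mul_inv_eq_one]
    exact hy.symm

/-- Anticoncentration of the image of a random walk in the integers. -/
lemma exists_tsum_walk_le {f : A →* Multiplicative ℤ} {s t : A} (hs : s ∈ ν.support)
    (ht : t ∈ ν.support) (hf : f (t * s⁻¹) ≠ 1) :
    ∃ K : ℝ, 0 < K ∧ ∀ (n : ℕ) (k : Multiplicative ℤ),
      ∑' y, walk ν n y * (if f y = k then 1 else 0) ≤ ENNReal.ofReal (K / √(n + 1)) := by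
  have hst : s ≠ t := by
    rintro rfl
    exact hf (by rw [mul_inv_cancel, map_one])
  obtain ⟨K, hK, hKb⟩ := exists_convOp_pow_le hs ht hst
  refine ⟨K, hK, fun n k => ?_⟩
  -- Convolution evaluates the test function at `y⁻¹` when taken at the point `1`, hence the fibre
  -- over `k⁻¹`.
  have h1 := orbitSum_le_one hf (b := fun y => if f y = k⁻¹ then 1 else 0)
    (fun y => by split_ifs <;> simp) (k := k⁻¹) (fun y hy => by simpa using hy)
  have := hKb n _ 1 h1 1
  rw [convOp_pow_apply, mul_one] at this
  simpa using this

end Anticoncentration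

/-! ### Integer coordinates and dual families of differences -/

section Structure

lemma exists_coordinates (G : Type*) [CommGroup G] [Group.FG G] :
    ∃ (r : Type) (_ : Fintype r) (φ : r → G →* Multiplicative ℤ) (e : r → G),
      (∀ i, φ i (e i) = Multiplicative.ofAdd 1) ∧ (∀ i j, i ≠ j → φ i (e j) = 1) ∧
        {x : G | ∀ i, φ i x = 1}.Finite := by
  classical
  obtain ⟨ι, r, _, _, p, hp, k, ⟨E⟩⟩ := CommGroup.equiv_free_prod_prod_multiplicative_zmod G
  have : ∀ i, NeZero (p i ^ k i) := fun i => ⟨pow_ne_zero _ (hp i).ne_zero⟩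
  have : ∀ i, Finite (Multiplicative (ZMod (p i ^ k i))) := fun i =>
    Finite.of_equiv (ZMod (p i ^ k i)) Multiplicative.ofAdd
  refine ⟨r, inferInstance,
    fun i => (Pi.evalMonoidHom _ i).comp ((MonoidHom.fst _ _).comp E.toMonoidHom),
    fun i => E.symm (Pi.mulSingle i (Multiplicative.ofAdd 1), 1), ?_, ?_, ?_⟩
  · intro i
    simp
  · intro i j hij
    simp [hij]
  -- Once the free coordinates vanish, an element is determined by its torsion part.
  · refine Set.Finite.of_finite_image (f := fun x => (E x).2) (Set.toFinite _) ?_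
    intro x hx y hy hxy
    refine E.injective (Prod.ext (funext fun i => ?_) hxy)
    exact (hx i).trans (hy i).symm

/-- A finite set of rational vectors contains a linearly independent family with a dual family of
functionals, so that the functionals separate points of the span. -/
lemma exists_dual_family {V : Type*} [AddCommGroup V] [Module ℚ V] (t : Set V) (ht : t.Finite) :
    ∃ (b : Set V) (_ : Fintype b) (L : b → V →ₗ[ℚ] ℚ), b ⊆ t ∧ (∀ i, L i i = 1) ∧
      (∀ i j : b, i ≠ j → L i j = 0) ∧ ∀ v ∈ Submodule.span ℚ t, (∀ i, L i v = 0) → v = 0 := by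
  obtain ⟨b, hbt, hspan, hli⟩ := exists_linearIndependent ℚ t
  have hbf : Fintype b := (ht.subset hbt).fintype
  let B := Module.Basis.span hli
  have hext : ∀ i : b, ∃ L : V →ₗ[ℚ] ℚ,
      L ∘ₗ (Submodule.span ℚ (Set.range ((↑) : b → V))).subtype = B.coord i := fun i =>
    LinearMap.exists_extend (B.coord i)
  choose L hL using hext
  have hB : ∀ i, ((B i : Submodule.span ℚ (Set.range ((↑) : b → V))) : V) = i := fun i =>
    congrArg Subtype.val (Module.Basis.span_apply hli i)
  have hLB : ∀ i j : b, L i j = B.repr (B j) i := fun i j => by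
    have := LinearMap.congr_fun (hL i) (B j)
    simpa [hB] using this
  refine ⟨b, hbf, L, hbt, fun i => ?_, fun i j hij => ?_, fun v hv h0 => ?_⟩
  · rw [hLB]
    simp
  · rw [hLB]
    simp [hij.symm]
  · have hv' : v ∈ Submodule.span ℚ (Set.range ((↑) : b → V)) := by
      rwa [Subtype.range_coe, hspan]
    have h1 : B.repr ⟨v, hv'⟩ = 0 := Finsupp.ext fun i => by
      have := LinearMap.congr_fun (hL i) ⟨v, hv'⟩
      simp only [LinearMap.comp_apply, Submodule.subtype_apply, h0, Module.Basis.coord_apply] at this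
      simpa using this.symm
    have h2 := B.repr.map_eq_zero_iff.1 h1
    exact congrArg Subtype.val h2

/-- A rational functional on the coordinates is, up to an integer multiple, a homomorphism to the
integers. -/
lemma exists_integral_multiple {G r : Type*} [CommGroup G] [Fintype r]
    (φ : r → G →* Multiplicative ℤ) (L : (r → ℚ) →ₗ[ℚ] ℚ) :
    ∃ (f : G →* Multiplicative ℤ) (D : ℤ), D ≠ 0 ∧
      ∀ x, ((f x).toAdd : ℚ) = D * L fun i => ((φ i x).toAdd : ℚ) := by
  classical
  -- `D` is a common denominator of the values of `L` on the standard basis.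
  obtain ⟨D, hD⟩ := IsLocalization.exist_integer_multiples_of_finite (nonZeroDivisors ℤ)
    fun i : r => L (Pi.single i 1)
  choose z hz using hD
  refine ⟨∏ i, (zpowGroupHom (z i)).comp (φ i), D, nonZeroDivisors.ne_zero D.2, fun x => ?_⟩
  have h1 : (fun i => ((φ i x).toAdd : ℚ)) =
      ∑ i, ((φ i x).toAdd : ℚ) • (Pi.single i 1 : r → ℚ) := by
    ext j
    simp [Finset.sum_apply, Pi.single_apply]
  rw [h1, map_sum, Finset.mul_sum, MonoidHom.finsetProd_apply, toAdd_prod, Int.cast_sum]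
  refine Finset.sum_congr rfl fun i _ => ?_
  have hzi : (z i : ℚ) = D * L (Pi.single i 1) := by
    simpa using hz i
  rw [MonoidHom.comp_apply, zpowGroupHom_apply, toAdd_zpow, smul_eq_mul, Int.cast_mul, hzi,
    map_smul, smul_eq_mul]
  ring

/-- A law not carried by a coset of a finite subgroup has differences with a dual family of
homomorphisms to the integers, which have finite common kernel on the group of differences. -/
lemma exists_dual_differences {G : Type*} [CommGroup G] [Group.FG G] (S : Set G) (hS : S.Finite)
    (hμ : ∀ (g : G) (H : Subgroup G), (H : Set G).Finite → ∃ s ∈ S, g⁻¹ * s ∉ H) :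
    ∃ (ι : Type) (_ : Fintype ι) (_ : Nonempty ι) (s₀ : G) (s : ι → G)
      (f : ι → G →* Multiplicative ℤ), s₀ ∈ S ∧ (∀ i, s i ∈ S) ∧ (∀ i, f i (s i * s₀⁻¹) ≠ 1) ∧
        (∀ i j, i ≠ j → f i (s j * s₀⁻¹) = 1) ∧
        {x | x ∈ Subgroup.closure ((fun y => y * s₀⁻¹) '' S) ∧ ∀ i, f i x = 1}.Finite := by
  obtain ⟨r, _, φ, -, -, -, hker⟩ := exists_coordinates G
  obtain ⟨s₀, hs₀, -⟩ := hμ 1 ⊥ (by simp)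
  let v : G → r → ℚ := fun x i => ((φ i x).toAdd : ℚ)
  have hv0 : ∀ x, v x = 0 → ∀ i, φ i x = 1 := fun x hx i => by
    have := congrFun hx i
    simpa [v] using this
  obtain ⟨b, _, L, hbt, hL1, hL0, hsep⟩ :=
    exists_dual_family (v '' ((fun y => y * s₀⁻¹) '' S)) ((hS.image _).image _)
  have hb : ∀ i : b, ∃ y ∈ S, v (y * s₀⁻¹) = i := fun i => by
    obtain ⟨_, ⟨y, hy, rfl⟩, e⟩ := hbt i.2
    exact ⟨y, hy, e⟩
  choose s hs hvs using hb
  choose f D hD hf using fun i => exists_integral_multiple φ (L i)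
  have hspan : ∀ x ∈ Subgroup.closure ((fun y => y * s₀⁻¹) '' S),
      v x ∈ Submodule.span ℚ (v '' ((fun y => y * s₀⁻¹) '' S)) := by
    intro x hx
    induction hx using Subgroup.closure_induction with
    | mem x hx => exact Submodule.subset_span ⟨x, hx, rfl⟩
    | one =>
      have : v 1 = 0 := by ext i; simp [v]
      rw [this]
      exact Submodule.zero_mem _
    | mul x y _ _ hx hy =>
      have : v (x * y) = v x + v y := by ext i; simp [v]
      rw [this]
      exact Submodule.add_mem _ hx hy
    | inv x _ hx =>
      have : v x⁻¹ = -v x := by ext i; simp [v]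
      rw [this]
      exact Submodule.neg_mem _ hx
  -- On the group of differences the `f i` detect every free coordinate: the rational vector of `x`
  -- lies in the span, where the dual functionals separate points.
  have hkill : ∀ x ∈ Subgroup.closure ((fun y => y * s₀⁻¹) '' S), (∀ i, f i x = 1) →
      ∀ i, φ i x = 1 := by
    intro x hx h1
    refine hv0 x (hsep _ (hspan x hx) fun i => ?_)
    have h := hf i x
    rw [h1 i, toAdd_one, Int.cast_zero] at h
    exact (mul_eq_zero.1 h.symm).resolve_left (by exact_mod_cast hD i)
  refine ⟨b, inferInstance, ?_, s₀, s, f, hs₀, hs, fun i h1 => ?_, fun i j hij => ?_,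
    hker.subset fun x hx => hkill x hx.1 hx.2⟩
  · by_contra hempty
    rw [not_nonempty_iff] at hempty
    -- With no index, every difference would lie in the finite subgroup `H`, and the support in the
    -- coset `s₀ H`.
    let H : Subgroup G := ⨅ i, (φ i).ker
    have hH : (H : Set G).Finite := hker.subset fun x hx => by
      simpa [H, Subgroup.mem_iInf, MonoidHom.mem_ker] using hx
    obtain ⟨y, hy, hyH⟩ := hμ s₀ H hH
    refine hyH ?_
    rw [mul_comm]
    simpa [H, Subgroup.mem_iInf, MonoidHom.mem_ker] using
      hkill (y * s₀⁻¹) (Subgroup.subset_closure ⟨y, hy, rfl⟩) fun i => hempty.elim i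
  · have h := hf i (s i * s₀⁻¹)
    change _ = _ * L i (v (s i * s₀⁻¹)) at h
    rw [hvs, hL1, mul_one, h1, toAdd_one, Int.cast_zero] at h
    exact hD i (by exact_mod_cast h.symm)
  · have h := hf i (s j * s₀⁻¹)
    change _ = _ * L i (v (s j * s₀⁻¹)) at h
    rw [hvs, hL0 i j hij, mul_zero] at h
    exact toAdd_eq_zero.1 (by exact_mod_cast h)

end Structure

/-! ### Word length against integer coordinates -/

section WordLength

variable {G : Type*} [CommGroup G] {T : Set G}

lemma wordLength_le (l : List G) (hl : ∀ x ∈ l, x ∈ T ∨ x⁻¹ ∈ T) :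
    wordLength T l.prod ≤ l.length :=
  Nat.sInf_le ⟨l, hl, rfl, rfl⟩

lemma exists_word (hT : Subgroup.closure T = ⊤) (g : G) :
    ∃ l : List G, (∀ x ∈ l, x ∈ T ∨ x⁻¹ ∈ T) ∧ l.prod = g ∧ l.length = wordLength T g := by
  have hg : g ∈ Subgroup.closure T := by simp [hT]
  rw [← Subgroup.mem_toSubmonoid, Subgroup.closure_toSubmonoid] at hg
  obtain ⟨l, hl, e⟩ := Submonoid.exists_list_of_mem_closure hg
  exact Nat.sInf_mem (s := {n | ∃ l : List G, (∀ x ∈ l, x ∈ T ∨ x⁻¹ ∈ T) ∧ l.prod = g ∧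
    l.length = n}) ⟨l.length, l, fun x hx => by simpa using hl x hx, e, rfl⟩

lemma wordLength_one : wordLength T (1 : G) = 0 :=
  Nat.le_zero.1 (wordLength_le (T := T) [] (by simp))

lemma wordLength_mul_le (hT : Subgroup.closure T = ⊤) (g h : G) :
    wordLength T (g * h) ≤ wordLength T g + wordLength T h := by
  obtain ⟨l, hl, rfl, e⟩ := exists_word hT g
  obtain ⟨l', hl', rfl, e'⟩ := exists_word hT h
  rw [← e, ← e', ← List.prod_append, ← List.length_append]
  refine wordLength_le _ fun x hx => ?_
  rcases List.mem_append.1 hx with hx | hx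
  exacts [hl x hx, hl' x hx]

lemma wordLength_inv_le (hT : Subgroup.closure T = ⊤) (g : G) :
    wordLength T g⁻¹ ≤ wordLength T g := by
  obtain ⟨l, hl, rfl, e⟩ := exists_word hT g
  rw [← e, List.prod_inv_reverse]
  refine (wordLength_le _ fun x hx => ?_).trans (by simp)
  simp only [List.mem_reverse, List.mem_map] at hx
  obtain ⟨y, hy, rfl⟩ := hx
  simpa [or_comm] using hl y hy

lemma wordLength_pow_le (hT : Subgroup.closure T = ⊤) (g : G) (n : ℕ) :
    wordLength T (g ^ n) ≤ n * wordLength T g := by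
  induction n with
  | zero => simp [wordLength_one]
  | succ n ih =>
    rw [pow_succ, add_mul, one_mul]
    exact (wordLength_mul_le hT _ _).trans (by gcongr)

lemma wordLength_zpow_le (hT : Subgroup.closure T = ⊤) (g : G) (k : ℤ) :
    wordLength T (g ^ k) ≤ k.natAbs * wordLength T g := by
  obtain ⟨n, rfl | rfl⟩ := k.eq_nat_or_neg
  · simpa using wordLength_pow_le hT g n
  · rw [zpow_neg, zpow_natCast, Int.natAbs_neg, Int.natAbs_natCast]
    exact (wordLength_inv_le hT _).trans (wordLength_pow_le hT g n)

lemma wordLength_prod_le (hT : Subgroup.closure T = ⊤) {ι : Type*} (s : Finset ι) (g : ι → G) :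
    wordLength T (∏ i ∈ s, g i) ≤ ∑ i ∈ s, wordLength T (g i) := by
  classical
  induction s using Finset.induction_on with
  | empty => simp [wordLength_one]
  | insert i s hi ih =>
    rw [Finset.prod_insert hi, Finset.sum_insert hi]
    exact (wordLength_mul_le hT _ _).trans (by gcongr)

/-- Word length is at most linear in integer coordinates. -/
lemma exists_wordLength_le [Group.FG G] (hT : Subgroup.closure T = ⊤) :
    ∃ (r : Type) (_ : Fintype r) (φ : r → G →* Multiplicative ℤ) (c : r → ℕ) (C : ℕ),
      ∀ g, (wordLength T g : ℝ) ≤ C + ∑ i, c i * |((φ i g).toAdd : ℝ)| := by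
  classical
  obtain ⟨r, _, φ, e, he, he', hker⟩ := exists_coordinates G
  refine ⟨r, inferInstance, φ, fun i => wordLength T (e i),
    ∑ x ∈ hker.toFinset, wordLength T x, fun g => ?_⟩
  -- `y` has the same integer coordinates as `g`, so `g * y⁻¹` ranges over a fixed finite set.
  set y := ∏ i, e i ^ (φ i g).toAdd with hy
  have hφy : ∀ i, φ i y = φ i g := by
    intro i
    rw [hy, map_prod, Finset.prod_eq_single i]
    · rw [map_zpow, he, ← ofAdd_zsmul, smul_eq_mul, mul_one, ofAdd_toAdd]
    · intro j _ hj
      rw [map_zpow, he' i j hj.symm, one_zpow]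
    · simp
  have hmem : g * y⁻¹ ∈ hker.toFinset := by
    simp [hφy]
  have h1 : wordLength T (g * y⁻¹) ≤ ∑ x ∈ hker.toFinset, wordLength T x :=
    Finset.single_le_sum (f := fun x => wordLength T x) (fun _ _ => Nat.zero_le _) hmem
  have h2 : wordLength T y ≤ ∑ i, (φ i g).toAdd.natAbs * wordLength T (e i) :=
    (wordLength_prod_le hT _ _).trans (Finset.sum_le_sum fun i _ => wordLength_zpow_le hT _ _)
  have h3 : wordLength T g ≤ wordLength T (g * y⁻¹) + wordLength T y := by
    simpa using wordLength_mul_le hT (g * y⁻¹) y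
  have h4 := h3.trans (add_le_add h1 h2)
  have h5 : (wordLength T g : ℝ) ≤ ((∑ x ∈ hker.toFinset, wordLength T x +
      ∑ i, (φ i g).toAdd.natAbs * wordLength T (e i) : ℕ) : ℝ) := by exact_mod_cast h4
  refine h5.trans (le_of_eq ?_)
  rw [Nat.cast_add]
  congr 1
  rw [Nat.cast_sum]
  refine Finset.sum_congr rfl fun i _ => ?_
  rw [Nat.cast_mul, Nat.cast_natAbs, Int.cast_abs, mul_comm]

/-- Homomorphisms to the integers are Lipschitz for the word length. -/
lemma exists_abs_le_wordLength (hTf : T.Finite) (hT : Subgroup.closure T = ⊤)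
    (f : G →* Multiplicative ℤ) :
    ∃ B : ℝ, 0 < B ∧ ∀ g, |((f g).toAdd : ℝ)| ≤ B * wordLength T g := by
  set B : ℝ := 1 + ∑ x ∈ hTf.toFinset, |((f x).toAdd : ℝ)| with hB
  have hTB : ∀ x ∈ T, |((f x).toAdd : ℝ)| ≤ B := fun x hx => by
    have := Finset.single_le_sum (f := fun x => |((f x).toAdd : ℝ)|) (fun _ _ => abs_nonneg _)
      (hTf.mem_toFinset.2 hx)
    linarith
  refine ⟨B, by positivity, fun g => ?_⟩
  obtain ⟨l, hl, rfl, e⟩ := exists_word hT g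
  rw [← e]
  clear e
  induction l with
  | nil => simp
  | cons x l ih =>
    have h1 := ih fun y hy => hl y (List.mem_cons_of_mem _ hy)
    have h2 : |((f x).toAdd : ℝ)| ≤ B := by
      rcases hl x List.mem_cons_self with h | h
      · exact hTB x h
      · simpa using hTB _ h
    rw [List.prod_cons, map_mul, toAdd_mul, Int.cast_add, List.length_cons]
    push_cast
    have h3 := abs_add_le ((f x).toAdd : ℝ) ((f l.prod).toAdd : ℝ)
    linarith

end WordLength

/-! ### Upper bound for the entropy of the walk -/

section EntropyUpperBound

lemma sum_pow_natAbs_le {x : ℝ} (hx : 0 ≤ x) (hx1 : x < 1) (Z : Finset ℤ) :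
    ∑ k ∈ Z, x ^ k.natAbs ≤ 2 * (1 - x)⁻¹ := by
  have half : ∀ W : Finset ℤ, Set.InjOn Int.natAbs (W : Set ℤ) →
      ∑ k ∈ W, x ^ k.natAbs ≤ (1 - x)⁻¹ := by
    intro W hW
    rw [← Finset.sum_image (f := fun n : ℕ => x ^ n) hW, ← tsum_geometric_of_lt_one hx hx1]
    exact (summable_geometric_of_lt_one hx hx1).sum_le_tsum _ fun _ _ => by positivity
  rw [← Finset.sum_filter_add_sum_filter_not Z (fun k => 0 ≤ k), two_mul]
  refine add_le_add (half _ ?_) (half _ ?_)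
  · intro a ha b hb hab
    simp at ha hb hab
    omega
  · intro a ha b hb hab
    simp at ha hb hab
    omega

/-- The total mass of a two-sided exponential weight of width `t` on the integers. -/
lemma sum_exp_neg_abs_sub_div_le {t : ℝ} (ht : 1 ≤ t) (c : ℝ) (Z : Finset ℤ) :
    ∑ k ∈ Z, Real.exp (-|(k : ℝ) - c| / t) ≤ 4 * Real.exp 1 * t := by
  have ht0 : 0 < t := by linarith
  set x := Real.exp (-1 / t) with hx
  have hx0 : 0 < x := Real.exp_pos _
  have hxle : x ≤ t / (t + 1) := by
    have h := Real.add_one_le_exp (1 / t)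
    have e : x = (Real.exp (1 / t))⁻¹ := by rw [hx, ← Real.exp_neg, neg_div]
    have h2 : t / (t + 1) = (1 / t + 1)⁻¹ := by field_simp; ring
    rw [e, h2]
    exact inv_anti₀ (by positivity) h
  have hx1 : x < 1 := hxle.trans_lt ((div_lt_one (by positivity)).2 (by linarith))
  have hinv : (1 - x)⁻¹ ≤ t + 1 := by
    rw [inv_le_comm₀ (by linarith) (by positivity)]
    have : (t + 1)⁻¹ = 1 - t / (t + 1) := by field_simp; ring
    linarith
  -- Moving the centre from `c` to the integer `⌊c⌋` costs a factor at most `exp 1`, because `t ≥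
  -- 1`.
  have term : ∀ k ∈ Z, Real.exp (-|(k : ℝ) - c| / t) ≤ Real.exp 1 * x ^ (k - ⌊c⌋).natAbs := by
    intro k _
    rw [hx, ← Real.exp_nat_mul, ← Real.exp_add, Nat.cast_natAbs, Int.cast_abs, Int.cast_sub]
    refine Real.exp_le_exp.2 ?_
    have h1 : |(k : ℝ) - ⌊c⌋| ≤ |(k : ℝ) - c| + 1 := by
      have h2 := abs_add_le ((k : ℝ) - c) (c - ⌊c⌋)
      have h3 : |c - ⌊c⌋| ≤ 1 := by
        rw [abs_le]
        constructor <;> linarith [Int.floor_le c, Int.lt_floor_add_one c]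
      rw [sub_add_sub_cancel] at h2
      linarith
    have h4 : |(k : ℝ) - ⌊c⌋| / t ≤ |(k : ℝ) - c| / t + 1 := by
      calc |(k : ℝ) - ⌊c⌋| / t ≤ (|(k : ℝ) - c| + 1) / t := by gcongr
        _ = |(k : ℝ) - c| / t + 1 / t := add_div _ _ _
        _ ≤ _ := by
          gcongr
          exact (div_le_one ht0).2 ht
    have h5 : |(k : ℝ) - ⌊c⌋| * (-1 / t) = -(|(k : ℝ) - ⌊c⌋| / t) := by ring
    have h6 : -|(k : ℝ) - c| / t = -(|(k : ℝ) - c| / t) := by ring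
    rw [h5, h6]
    linarith
  refine (Finset.sum_le_sum term).trans ?_
  rw [← Finset.mul_sum]
  have hinj : Set.InjOn (fun k : ℤ => k - ⌊c⌋) (Z : Set ℤ) := fun a _ b _ h => by
    simpa using h
  have h := sum_pow_natAbs_le hx0.le hx1 (Z.image fun k => k - ⌊c⌋)
  rw [Finset.sum_image hinj] at h
  calc Real.exp 1 * ∑ k ∈ Z, x ^ (k - ⌊c⌋).natAbs
      ≤ Real.exp 1 * (2 * (t + t)) := by
        gcongr
        exact h.trans (by linarith)
    _ = _ := by ring

variable {G : Type*} [CommGroup G] {μ : PMF G}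

/-- At each time the walk stays in a single coset of the group of differences, so finiteness of the
common kernel is needed only on that group. -/
lemma mem_closure_of_mem_support_walk {s₀ : G} (n : ℕ) {x : G} (hx : x ∈ (walk μ n).support) :
    x * (s₀ ^ n)⁻¹ ∈ Subgroup.closure ((fun y => y * s₀⁻¹) '' μ.support) := by
  induction n generalizing x with
  | zero =>
    have : x = 1 := by simpa [walk] using hx
    simp [this]
  | succ n ih =>
    simp only [walk, PMF.mem_support_bind_iff, PMF.mem_support_pure_iff] at hx
    obtain ⟨y, hy, s, hs, rfl⟩ := hx
    have e : y * s * (s₀ ^ (n + 1))⁻¹ = y * (s₀ ^ n)⁻¹ * (s * s₀⁻¹) := by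
      rw [pow_succ, mul_inv, mul_mul_mul_comm]
    rw [e]
    exact Subgroup.mul_mem _ (ih hy) (Subgroup.subset_closure ⟨s, hs, rfl⟩)

/-- The entropy of a random walk on an abelian group grows at most like `(d / 2) log n`, where `d`
is the rank of the group of differences of the support. -/
lemma exists_entropy_walk_le (hμ : μ.support.Finite) {ι : Type*} [Fintype ι] {s₀ : G}
    {f : ι → G →* Multiplicative ℤ}
    (hF : {x | x ∈ Subgroup.closure ((fun y => y * s₀⁻¹) '' μ.support) ∧
      ∀ i, f i x = 1}.Finite) :
    ∃ C : ℝ, ∀ n : ℕ,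
      entropy (walk μ n) ≤ (Fintype.card ι : ℝ) / 2 * Real.log (n + 1) + C := by
  classical
  set N : ℝ := (hF.toFinset.card : ℝ) with hN
  have hN0 : 0 < N := by
    have : 0 < hF.toFinset.card := Finset.card_pos.2 ⟨1, by simp⟩
    rw [hN]
    exact_mod_cast this
  set z : ι → G → ℝ := fun i x => ((f i x).toAdd : ℝ) with hz
  have hzadd : ∀ i x y, z i (x * y) = z i x + z i y := fun i x y => by simp [hz]
  set V : ι → ℝ := fun i => mean μ fun s => (z i s - mean μ (z i)) ^ 2 with hV
  have hV0 : ∀ i, 0 ≤ V i := fun i => mean_nonneg fun _ => sq_nonneg _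
  refine ⟨∑ i, √(V i) + (Real.log N + Fintype.card ι * Real.log (4 * Real.exp 1)), fun n => ?_⟩
  have hw := finite_support_walk hμ n
  set t := √((n : ℝ) + 1) with ht
  have ht1 : 1 ≤ t := Real.one_le_sqrt.2 (by linarith [n.cast_nonneg (α := ℝ)])
  have ht0 : 0 < t := by linarith
  set c : ι → ℝ := fun i => n * mean μ (z i) with hc
  -- The comparison weight: a product of exponentials centred at the mean position, of width `√(n +
  -- 1)`. Its mean logarithmic cost stays bounded, and its total mass grows like the width to the
  -- power `Fintype.card ι`.
  set g : (ι → ℤ) → ℝ := fun k => ∏ i, Real.exp (-|(k i : ℝ) - c i| / t) with hg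
  set Z : G → ι → ℤ := fun x i => (f i x).toAdd with hZ
  have hg0 : ∀ k, 0 < g k := fun k => Finset.prod_pos fun i _ => Real.exp_pos _
  have hsum : ∑ x ∈ hw.toFinset, g (Z x) ≤ N * (4 * Real.exp 1 * t) ^ Fintype.card ι := by
    rw [Finset.sum_comp g Z]
    have hfib : ∀ k ∈ hw.toFinset.image Z,
        ({x ∈ hw.toFinset | Z x = k} : Finset G).card • g k ≤ N * g k := by
      intro k hk
      rw [nsmul_eq_mul]
      refine mul_le_mul_of_nonneg_right ?_ (hg0 k).le
      obtain ⟨x₀, hx₀, rfl⟩ := Finset.mem_image.1 hk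
      rw [hN, Nat.cast_le]
      -- Two points of the walk with equal coordinates differ by an element of the finite common
      -- kernel, so each fibre has at most `N` points.
      refine Finset.card_le_card_of_injOn (fun x => x * x₀⁻¹) ?_ fun x _ y _ h => by simpa using h
      intro x hx
      simp only [Finset.coe_filter, Set.mem_ofPred_eq, Set.Finite.mem_toFinset] at hx hx₀
      have h1 := mem_closure_of_mem_support_walk (s₀ := s₀) n hx.1
      have h2 := mem_closure_of_mem_support_walk (s₀ := s₀) n hx₀
      have h3 := Subgroup.mul_mem _ h1 (Subgroup.inv_mem _ h2)
      have e : x * (s₀ ^ n)⁻¹ * (x₀ * (s₀ ^ n)⁻¹)⁻¹ = x * x₀⁻¹ := by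
        rw [← div_eq_mul_inv (x * _), mul_div_mul_right_eq_div, div_eq_mul_inv]
      rw [e] at h3
      simp only [Set.Finite.coe_toFinset, Set.mem_ofPred_eq]
      refine ⟨h3, fun i => ?_⟩
      have h4 : f i x = f i x₀ := by
        have := congrFun hx.2 i
        exact Multiplicative.toAdd.injective this
      rw [map_mul, map_inv, h4, mul_inv_cancel]
    refine (Finset.sum_le_sum hfib).trans ?_
    rw [← Finset.mul_sum]
    refine mul_le_mul_of_nonneg_left ?_ hN0.le
    have hsub : hw.toFinset.image Z ⊆
        Fintype.piFinset fun i => hw.toFinset.image fun x => Z x i := by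
      intro k hk
      obtain ⟨x, hx, rfl⟩ := Finset.mem_image.1 hk
      exact Fintype.mem_piFinset.2 fun i => Finset.mem_image_of_mem (fun x => Z x i) hx
    refine (Finset.sum_le_sum_of_subset_of_nonneg hsub fun k _ _ => (hg0 k).le).trans ?_
    have hprod := Finset.prod_univ_sum (fun i => hw.toFinset.image fun x => Z x i)
      fun i (k : ℤ) => Real.exp (-|(k : ℝ) - c i| / t)
    rw [hg, ← hprod, Fintype.card, ← Finset.prod_const]
    exact Finset.prod_le_prod (fun i _ => Finset.sum_nonneg fun _ _ => (Real.exp_pos _).le)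
      fun i _ => sum_exp_neg_abs_sub_div_le ht1 _ _
  have hpos : 0 < N * (4 * Real.exp 1 * t) ^ Fintype.card ι := by positivity
  refine (entropy_le_mean_neg_log_add hw (fun x _ => hg0 (Z x)) hpos hsum).trans ?_
  have hmean : mean (walk μ n) (fun x => -Real.log (g (Z x))) ≤ ∑ i, √(V i) := by
    have e : (fun x => -Real.log (g (Z x))) = fun x => ∑ i, t⁻¹ * |z i x - c i| := by
      ext x
      rw [hg, Real.log_prod fun i _ => (Real.exp_pos _).ne', ← Finset.sum_neg_distrib]
      refine Finset.sum_congr rfl fun i _ => ?_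
      rw [Real.log_exp]
      simp only [hz, hZ]
      ring
    rw [e, mean_sum hw]
    refine Finset.sum_le_sum fun i _ => ?_
    rw [mean_const_mul, inv_mul_le_iff₀ ht0, ht, ← Real.sqrt_mul (by positivity)]
    refine mean_abs_le hw _ ?_
    rw [mean_walk_variance hμ (hzadd i)]
    exact mul_le_mul_of_nonneg_right (by linarith) (hV0 i)
  have hlog : Real.log (N * (4 * Real.exp 1 * t) ^ Fintype.card ι) =
      (Fintype.card ι : ℝ) / 2 * Real.log (n + 1) +
        (Real.log N + Fintype.card ι * Real.log (4 * Real.exp 1)) := by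
    rw [Real.log_mul hN0.ne' (by positivity), Real.log_pow, Real.log_mul (by positivity) ht0.ne',
      ht, Real.log_sqrt (by positivity)]
    ring
  rw [hlog]
  linarith

end EntropyUpperBound

/-! ### Entropy noise sensitivity -/

section EntropySensitivity

variable {G : Type*} [CommGroup G] {μ : PMF G}

/-- The joint entropy of the walk and its noised version grows at least like `d log n`. -/
lemma exists_le_entropy_noisyLaw (hμ : μ.support.Finite) {ρ : unitInterval} (hρ : 0 < ρ)
    {ι : Type*} [Fintype ι] [Nonempty ι] {s₀ : G} {s : ι → G} {f : ι → G →* Multiplicative ℤ}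
    (hs₀ : s₀ ∈ μ.support) (hs : ∀ i, s i ∈ μ.support) (hf : ∀ i, f i (s i * s₀⁻¹) ≠ 1)
    (hf' : ∀ i j, i ≠ j → f i (s j * s₀⁻¹) = 1) :
    ∃ C : ℝ, ∀ n : ℕ,
      (Fintype.card ι : ℝ) * Real.log (n + 1) - C ≤ entropy (noisyLaw μ ρ n) := by
  obtain ⟨K, hK, hKb⟩ := exists_walk_le (ν := noisyStep μ ρ) (ι := ι ⊕ ι)
    -- Each difference is used once in each factor of `G × G`, giving `2 * Fintype.card ι`
    -- independent directions.
    (h := Sum.elim (fun i => (s i * s₀⁻¹, 1)) fun i => (1, s i * s₀⁻¹))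
    (f := Sum.elim (fun i => (f i).comp (MonoidHom.fst G G))
      fun i => (f i).comp (MonoidHom.snd G G))
    (by rintro (i | i) <;> simpa using hf i)
    (by
      rintro (i | i) (j | j) hij
      · simpa using hf' i j (by simpa using hij)
      · simp
      · simp
      · simpa using hf' i j (by simpa using hij))
    (by
      rintro (i | i)
      · exact ⟨_, noisyStep_ne_zero hρ hs₀ hs₀, _, noisyStep_ne_zero hρ (hs i) hs₀, by simp⟩
      · exact ⟨_, noisyStep_ne_zero hρ hs₀ hs₀, _, noisyStep_ne_zero hρ hs₀ (hs i), by simp⟩)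
  refine ⟨Real.log K, fun n => ?_⟩
  refine le_trans (le_of_eq ?_) (neg_log_le_entropy (finite_support_noisyLaw hμ ρ n) (hKb n))
  have hn : (0 : ℝ) < n + 1 := by positivity
  rw [Real.log_div hK.ne' (by positivity), Real.log_pow, Real.log_sqrt hn.le, Fintype.card_sum]
  push_cast
  ring

/-- The bounds leave only a bounded gap, `b - (2C + C') ≤ a ≤ b`, while `2b ≥ a + b` forces `b` to
infinity. -/
lemma tendsto_div_one_of_bounds {a b L : ℕ → ℝ} {d C C' : ℝ} (hd : 0 < d)
    (hL : Tendsto L atTop atTop) (hab : ∀ n, a n ≤ b n) (hb : ∀ n, b n ≤ d / 2 * L n + C)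
    (hsum : ∀ n, d * L n - C' ≤ a n + b n) : Tendsto (fun n => a n / b n) atTop (𝓝 1) := by
  have hbtop : Tendsto b atTop atTop := by
    have h : Tendsto (fun n => d / 2 * L n + -(C' / 2)) atTop atTop :=
      tendsto_atTop_add_const_right _ _ (hL.const_mul_atTop (by positivity))
    exact tendsto_atTop_mono (fun n => by linarith [hab n, hsum n]) h
  have h0 : Tendsto (fun n => 1 - (2 * C + C') / b n) atTop (𝓝 1) := by
    simpa using tendsto_const_nhds.sub (tendsto_const_nhds.div_atTop hbtop)
  refine tendsto_of_tendsto_of_tendsto_of_le_of_le' h0 tendsto_const_nhds ?_ ?_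
  · filter_upwards [hbtop.eventually_gt_atTop 0] with n hn
    rw [one_sub_div hn.ne']
    gcongr
    linarith [hb n, hsum n]
  · filter_upwards [hbtop.eventually_gt_atTop 0] with n hn
    exact (div_le_one hn).2 (hab n)

theorem entropyNoiseSensitive [Group.FG G] (hfin : μ.support.Finite)
    (hμ : ∀ (g : G) (H : Subgroup G), (H : Set G).Finite → ∃ s ∈ μ.support, g⁻¹ * s ∉ H) :
    EntropyNoiseSensitive μ := by
  intro ρ hρ _
  obtain ⟨ι, _, _, s₀, s, f, hs₀, hs, hf, hf', hF⟩ := exists_dual_differences _ hfin hμ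
  obtain ⟨C, hC⟩ := exists_entropy_walk_le hfin hF
  obtain ⟨C', hC'⟩ := exists_le_entropy_noisyLaw hfin hρ hs₀ hs hf hf'
  have hd : (0 : ℝ) < Fintype.card ι := by exact_mod_cast Fintype.card_pos
  have hL : Tendsto (fun n : ℕ => Real.log ((n : ℝ) + 1)) atTop atTop :=
    Real.tendsto_log_atTop.comp (tendsto_atTop_add_const_right _ _ tendsto_natCast_atTop_atTop)
  refine tendsto_div_one_of_bounds (C' := C') hd hL (fun n => ?_) hC fun n => ?_
  · rw [← noisyLaw_map_snd μ ρ n]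
    exact condEntropy_le (finite_support_noisyLaw hfin ρ n)
  · rw [condEntropy_eq (finite_support_noisyLaw hfin ρ n), noisyLaw_map_fst, sub_add_cancel]
    exact hC' n

end EntropySensitivity

/-! ### Failure of `ℓ¹` and distance noise sensitivity -/

section Distance

lemma mean_sub_mean_le_l1Dist {E : Type*} {ξ η : PMF E} (hξ : ξ.support.Finite)
    (hη : η.support.Finite) {g : E → ℝ} (hg : ∀ x, |g x| ≤ 1) :
    mean ξ g - mean η g ≤ l1Dist ξ η := by
  classical
  set S := hξ.toFinset ∪ hη.toFinset
  have hS : ξ.support ⊆ S := fun x hx => by simp [S, hx]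
  have hS' : η.support ⊆ S := fun x hx => by simp [S, hx]
  rw [mean_eq_sum S hS, mean_eq_sum S hS', l1Dist, tsum_eq_sum (s := S) fun x hx => by
    simp [apply_eq_zero_of_notMem hS hx, apply_eq_zero_of_notMem hS' hx],
    ← Finset.sum_sub_distrib]
  refine Finset.sum_le_sum fun x _ => ?_
  rw [← sub_mul]
  refine (le_abs_self _).trans ?_
  rw [abs_mul]
  exact mul_le_of_le_one_right (abs_nonneg _) (hg x)

variable {G : Type*} [CommGroup G] {μ : PMF G}

/-- The indicator of the event that the second value of `f` is at distance at most `R` from the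
first one. -/
def closeIndicator (f : G →* Multiplicative ℤ) (R : ℝ) (p : G × G) : ℝ :=
  open Classical in if |((f p.2).toAdd : ℝ) - (f p.1).toAdd| ≤ R then 1 else 0

lemma abs_closeIndicator_le (f : G →* Multiplicative ℤ) (R : ℝ) (p : G × G) :
    |closeIndicator f R p| ≤ 1 := by
  unfold closeIndicator
  split_ifs <;> simp

lemma closeIndicator_le_sum (f : G →* Multiplicative ℤ) {R : ℝ} (x y : G) :
    closeIndicator f R (x, y) ≤
      ∑ k ∈ Finset.Icc ((f x).toAdd - ⌊R⌋) ((f x).toAdd + ⌊R⌋),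
        if f y = Multiplicative.ofAdd k then (1 : ℝ) else 0 := by
  unfold closeIndicator
  split_ifs with h
  · have hmem : (f y).toAdd ∈ Finset.Icc ((f x).toAdd - ⌊R⌋) ((f x).toAdd + ⌊R⌋) := by
      have h1 : |(f y).toAdd - (f x).toAdd| ≤ ⌊R⌋ := by
        rw [Int.le_floor]
        push_cast
        exact h
      rw [abs_le] at h1
      rw [Finset.mem_Icc]
      constructor <;> linarith
    have := Finset.single_le_sum (s := Finset.Icc ((f x).toAdd - ⌊R⌋) ((f x).toAdd + ⌊R⌋))
      (f := fun k => if f y = Multiplicative.ofAdd k then (1 : ℝ) else 0)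
      (fun k _ => by positivity) hmem
    simpa using this
  · exact Finset.sum_nonneg fun k _ => by positivity

/-- Two independent walks are at distance of order `√n` with probability at least one half. -/
lemma exists_mean_closeIndicator_indepLaw_le (hμ : μ.support.Finite) {f : G →* Multiplicative ℤ}
    {s t : G} (hs : s ∈ μ.support) (ht : t ∈ μ.support) (hf : f (t * s⁻¹) ≠ 1) :
    ∃ κ : ℝ, 0 < κ ∧ ∀ᶠ n : ℕ in atTop,
      mean (indepLaw μ n) (closeIndicator f (κ * √(n + 1))) ≤ 1 / 2 := by
  obtain ⟨K, hK, hKb⟩ := exists_tsum_walk_le hs ht hf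
  have hlim : Tendsto (fun n : ℕ => √((n : ℝ) + 1)) atTop atTop :=
    Real.tendsto_sqrt_atTop.comp (tendsto_atTop_add_const_right _ _ tendsto_natCast_atTop_atTop)
  -- An interval of radius `κ u` has at most `2κu + 1` integers, each of mass at most `K / u`. The
  -- total is `1 / 4 + K / u`, at most `1 / 2` once `u ≥ 4K`.
  refine ⟨1 / (8 * K), by positivity, ?_⟩
  filter_upwards [hlim.eventually_ge_atTop (4 * K)] with n hn
  have hw := finite_support_walk hμ n
  set u := √((n : ℝ) + 1) with hu
  have hu0 : 0 < u := Real.sqrt_pos.2 (by positivity)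
  set R := 1 / (8 * K) * u with hR
  have hR0 : 0 ≤ R := by positivity
  have hatom : ∀ k, mean (walk μ n) (fun y => if f y = Multiplicative.ofAdd k then (1 : ℝ) else 0)
      ≤ K / u := by
    intro k
    refine le_trans (le_of_eq ?_)
      (ENNReal.toReal_le_of_le_ofReal (by positivity) (hKb n (Multiplicative.ofAdd k)))
    rw [ENNReal.tsum_toReal_eq]
    · refine tsum_congr fun y => ?_
      by_cases h : f y = Multiplicative.ofAdd k <;> simp [h]
    · intro y
      by_cases h : f y = Multiplicative.ofAdd k
      · simpa [h] using (walk μ n).apply_ne_top y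
      · simp [h]
  have hinner : ∀ x, mean (walk μ n) (fun y => closeIndicator f R (x, y)) ≤ 1 / 2 := by
    intro x
    refine (mean_mono hw fun y _ => closeIndicator_le_sum f x y).trans ?_
    rw [mean_sum hw]
    refine (Finset.sum_le_card_nsmul _ _ _ fun k _ => hatom k).trans ?_
    rw [nsmul_eq_mul, Int.card_Icc]
    have hfl : (0 : ℤ) ≤ ⌊R⌋ := Int.floor_nonneg.2 hR0
    have hcard : (((f x).toAdd + ⌊R⌋ + 1 - ((f x).toAdd - ⌊R⌋)).toNat : ℝ) ≤ 2 * R + 1 := by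
      have e : (f x).toAdd + ⌊R⌋ + 1 - ((f x).toAdd - ⌊R⌋) = 2 * ⌊R⌋ + 1 := by ring
      have h1 : (((2 * ⌊R⌋ + 1).toNat : ℤ) : ℝ) = ((2 * ⌊R⌋ + 1 : ℤ) : ℝ) := by
        rw [Int.toNat_of_nonneg (by linarith)]
      rw [e, ← Int.cast_natCast, h1]
      push_cast
      linarith [Int.floor_le R]
    calc _ ≤ (2 * R + 1) * (K / u) := by gcongr
      _ = 1 / 4 + K / u := by
        rw [hR]
        field_simp
        ring
      _ ≤ 1 / 2 := by
        have : K / u ≤ 1 / 4 := by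
          rw [div_le_div_iff₀ hu0 (by norm_num)]
          linarith
        linarith
  rw [indepLaw, mean_indep hw hw]
  calc _ ≤ mean (walk μ n) (fun _ => 1 / 2) := mean_mono hw fun x _ => hinner x
    _ = 1 / 2 := mean_const hw _

/-- A walk and its noised version are typically closer than `κ √n` when the noise is small. -/
lemma le_mean_closeIndicator_noisyLaw (hμ : μ.support.Finite) (f : G →* Multiplicative ℤ)
    (ρ : unitInterval) {κ : ℝ} (hκ : 0 < κ) (n : ℕ) :
    1 - ρ * (mean μ fun s => mean μ fun s' => (((f s').toAdd : ℝ) - (f s).toAdd) ^ 2) / κ ^ 2 ≤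
      mean (noisyLaw μ ρ n) (closeIndicator f (κ * √(n + 1))) := by
  have hπ := finite_support_noisyLaw hμ ρ n
  set V := mean μ fun s => mean μ fun s' => (((f s').toAdd : ℝ) - (f s).toAdd) ^ 2 with hV
  have hV0 : 0 ≤ V := mean_nonneg fun _ => mean_nonneg fun _ => sq_nonneg _
  have hsq := mean_noisyLaw_sq hμ ρ (f := fun x => ((f x).toAdd : ℝ)) (fun x y => by simp) n
  have hn : (0 : ℝ) < n + 1 := by positivity
  set R := κ * √((n : ℝ) + 1) with hR
  have hR2 : R ^ 2 = κ ^ 2 * (n + 1) := by rw [hR, mul_pow, Real.sq_sqrt hn.le]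
  have hR0 : 0 < R := by positivity
  -- Chebyshev's inequality in pointwise form.
  have hpt : ∀ p ∈ (noisyLaw μ ρ n).support,
      1 - (R ^ 2)⁻¹ * (((f p.2).toAdd : ℝ) - (f p.1).toAdd) ^ 2 ≤ closeIndicator f R p := by
    intro p _
    unfold closeIndicator
    split_ifs with h
    · have : 0 ≤ (R ^ 2)⁻¹ * (((f p.2).toAdd : ℝ) - (f p.1).toAdd) ^ 2 := by positivity
      linarith
    · rw [not_le] at h
      have h2 : R ^ 2 ≤ (((f p.2).toAdd : ℝ) - (f p.1).toAdd) ^ 2 := by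
        rw [← sq_abs (_ - _)]
        gcongr
      have h3 := (one_le_inv_mul₀ (by positivity : 0 < R ^ 2)).2 h2
      linarith
  refine le_trans ?_ (mean_mono hπ hpt)
  rw [mean_sub hπ, mean_const hπ, mean_const_mul, hsq, ← hV, hR2]
  have : (κ ^ 2 * ((n : ℝ) + 1))⁻¹ * ((n : ℝ) * ((ρ : ℝ) * V)) ≤ (ρ : ℝ) * V / κ ^ 2 := by
    rw [inv_mul_le_iff₀ (by positivity)]
    have hρ0 : (0 : ℝ) ≤ ρ := ρ.2.1
    have e : κ ^ 2 * ((n : ℝ) + 1) * ((ρ : ℝ) * V / κ ^ 2) = (n + 1) * ((ρ : ℝ) * V) := by field_simp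
    rw [e]
    exact mul_le_mul_of_nonneg_right (by linarith) (by positivity)
  linarith

lemma exists_noise_mul_le {V δ : ℝ} (hV : 0 ≤ V) (hδ : 0 < δ) :
    ∃ ρ : unitInterval, 0 < ρ ∧ ρ < 1 ∧ (ρ : ℝ) * V ≤ δ := by
  -- The denominator is `V + 1` because `V` may vanish; the cap `1 / 2` keeps `ρ` below `1`.
  have hpos : 0 < min (1 / 2) (δ / (V + 1)) := lt_min (by norm_num) (by positivity)
  have hle : min (1 / 2) (δ / (V + 1)) ≤ 1 / 2 := min_le_left _ _
  refine ⟨⟨min (1 / 2) (δ / (V + 1)), hpos.le, by linarith⟩, hpos, ?_, ?_⟩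
  · change min (1 / 2) (δ / (V + 1)) < 1
    linarith
  · calc min (1 / 2) (δ / (V + 1)) * V ≤ δ / (V + 1) * (V + 1) :=
        mul_le_mul (min_le_right _ _) (by linarith) hV (by positivity)
      _ = δ := by field_simp

theorem not_l1NoiseSensitive (hμ : μ.support.Finite) {f : G →* Multiplicative ℤ}
    {s t : G} (hs : s ∈ μ.support) (ht : t ∈ μ.support) (hf : f (t * s⁻¹) ≠ 1) :
    ¬ L1NoiseSensitive μ := by
  intro hsens
  obtain ⟨κ, hκ, hind⟩ := exists_mean_closeIndicator_indepLaw_le hμ hs ht hf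
  -- For this `ρ` the closeness event has probability at least `3 / 4` under noise, against at most
  -- `1 / 2` for independent walks at large times.
  obtain ⟨ρ, hρ, hρ1, hρV⟩ := exists_noise_mul_le
    (mean_nonneg (ξ := μ) fun s => mean_nonneg (ξ := μ) fun s' =>
      sq_nonneg (((f s').toAdd : ℝ) - (f s).toAdd)) (by positivity : 0 < κ ^ 2 / 4)
  have hlim := hsens ρ hρ hρ1
  obtain ⟨n, hn, hn'⟩ := (hind.and (hlim.eventually_lt_const (by norm_num : (0 : ℝ) < 1 / 4))).exists
  have h1 := le_mean_closeIndicator_noisyLaw hμ f ρ hκ n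
  have hπ : (indepLaw μ n).support.Finite :=
    finite_support_indep (finite_support_walk hμ n) (finite_support_walk hμ n)
  have h2 := mean_sub_mean_le_l1Dist (finite_support_noisyLaw hμ ρ n) hπ
    (abs_closeIndicator_le f (κ * √(n + 1)))
  have h3 := div_le_div_of_nonneg_right hρV (sq_nonneg κ)
  have h4 : κ ^ 2 / 4 / κ ^ 2 = 1 / 4 := by field_simp
  linarith

variable {T : Set G}

lemma exists_le_expDist_indepLaw (hTf : T.Finite) (hT : Subgroup.closure T = ⊤)
    (hμ : μ.support.Finite) {f : G →* Multiplicative ℤ}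
    {s t : G} (hs : s ∈ μ.support) (ht : t ∈ μ.support) (hf : f (t * s⁻¹) ≠ 1) :
    ∃ a : ℝ, 0 < a ∧ ∀ᶠ n : ℕ in atTop, a * √(n + 1) ≤ expDist T (indepLaw μ n) := by
  obtain ⟨κ, hκ, hind⟩ := exists_mean_closeIndicator_indepLaw_le hμ hs ht hf
  obtain ⟨B, hB, hBb⟩ := exists_abs_le_wordLength hTf hT f
  refine ⟨κ / (2 * B), by positivity, ?_⟩
  filter_upwards [hind] with n hn
  have hπ : (indepLaw μ n).support.Finite :=
    finite_support_indep (finite_support_walk hμ n) (finite_support_walk hμ n)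
  set R := κ * √((n : ℝ) + 1) with hR
  have hR0 : 0 ≤ R := by positivity
  have hpt : ∀ p ∈ (indepLaw μ n).support,
      R / B * (1 - closeIndicator f R p) ≤ (wordDist T p.1 p.2 : ℝ) := by
    intro p _
    unfold closeIndicator
    split_ifs with h
    · simp
    · rw [sub_zero, mul_one, div_le_iff₀' hB]
      refine (not_le.1 h).le.trans (le_trans (le_of_eq ?_) (hBb (p.1⁻¹ * p.2)))
      rw [map_mul, map_inv, toAdd_mul, toAdd_inv]
      push_cast
      congr 1
      ring
  have h := mean_mono hπ hpt
  rw [mean_const_mul, mean_sub hπ, mean_const hπ] at h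
  refine le_trans ?_ h
  calc κ / (2 * B) * √((n : ℝ) + 1) = R / B * (1 - 1 / 2) := by rw [hR]; field_simp; ring
    _ ≤ _ := by gcongr

/-- The constants do not depend on `ρ`: each integer coordinate of the displacement has second
moment linear in `ρ n`, hence mean absolute value of order `√(ρ n)`, and `C` absorbs the torsion. -/
lemma exists_expDist_noisyLaw_le [Group.FG G] (hT : Subgroup.closure T = ⊤)
    (hμ : μ.support.Finite) :
    ∃ C W : ℝ, 0 ≤ W ∧ ∀ (ρ : unitInterval) (n : ℕ),
      expDist T (noisyLaw μ ρ n) ≤ C + √ρ * W * √(n + 1) := by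
  obtain ⟨r, _, φ, c, C, hC⟩ := exists_wordLength_le hT
  set V : r → ℝ := fun i =>
    mean μ fun s => mean μ fun s' => (((φ i s').toAdd : ℝ) - (φ i s).toAdd) ^ 2 with hV
  have hV0 : ∀ i, 0 ≤ V i := fun i => mean_nonneg fun _ => mean_nonneg fun _ => sq_nonneg _
  refine ⟨C, ∑ i, c i * √(V i), by positivity, fun ρ n => ?_⟩
  have hπ := finite_support_noisyLaw hμ ρ n
  have hρ0 : (0 : ℝ) ≤ ρ := ρ.2.1
  have hpt : ∀ p ∈ (noisyLaw μ ρ n).support, (wordDist T p.1 p.2 : ℝ) ≤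
      C + ∑ i, c i * |((φ i p.2).toAdd : ℝ) - (φ i p.1).toAdd| := by
    intro p _
    refine (hC _).trans (le_of_eq ?_)
    congr 1
    refine Finset.sum_congr rfl fun i _ => ?_
    rw [map_mul, map_inv, toAdd_mul, toAdd_inv]
    push_cast
    congr 2
    ring
  refine (mean_mono hπ hpt).trans ?_
  rw [mean_add hπ, mean_const hπ, mean_sum hπ, Finset.mul_sum, Finset.sum_mul]
  refine add_le_add le_rfl (Finset.sum_le_sum fun i _ => ?_)
  rw [mean_const_mul]
  have h : mean (noisyLaw μ ρ n) (fun p => |((φ i p.2).toAdd : ℝ) - (φ i p.1).toAdd|) ≤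
      √((n + 1) * (ρ * V i)) := by
    refine mean_abs_le hπ _ ?_
    rw [mean_noisyLaw_sq hμ ρ (f := fun x => ((φ i x).toAdd : ℝ)) (fun x y => by simp) n]
    have := hV0 i
    exact mul_le_mul_of_nonneg_right (by linarith) (by positivity)
  rw [Real.sqrt_mul (by positivity), Real.sqrt_mul hρ0] at h
  calc _ ≤ (c i : ℝ) * (√(n + 1) * (√ρ * √(V i))) := by gcongr
    _ = _ := by ring

/-- For small noise, the noised walk is closer to the walk than an independent copy by an
arbitrarily small factor. -/
lemma exists_expDist_noisyLaw_lt [Group.FG G] (hTf : T.Finite) (hT : Subgroup.closure T = ⊤)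
    (hμ : μ.support.Finite) {f : G →* Multiplicative ℤ}
    {s t : G} (hs : s ∈ μ.support) (ht : t ∈ μ.support) (hf : f (t * s⁻¹) ≠ 1)
    {ε : ℝ} (hε : 0 < ε) :
    ∃ ρ : unitInterval, 0 < ρ ∧ ρ < 1 ∧ ∀ᶠ n : ℕ in atTop, 0 < expDist T (indepLaw μ n) ∧
      expDist T (noisyLaw μ ρ n) < ε * expDist T (indepLaw μ n) := by
  obtain ⟨a, ha, hlow⟩ := exists_le_expDist_indepLaw hTf hT hμ hs ht hf
  obtain ⟨C, W, hW, hup⟩ := exists_expDist_noisyLaw_le hT hμ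
  -- Chosen so that `√ρ * W ≤ ε * a / 2`, half of the allowed rate; the other half absorbs `C` for
  -- large `n`.
  obtain ⟨ρ, hρ, hρ1, hρW⟩ := exists_noise_mul_le (sq_nonneg W)
    (by positivity : 0 < (ε * a / 2) ^ 2)
  refine ⟨ρ, hρ, hρ1, ?_⟩
  have hρ0 : (0 : ℝ) ≤ ρ := ρ.2.1
  have hsq : √ρ * W ≤ ε * a / 2 := by
    refine le_of_sq_le_sq ?_ (by positivity)
    rwa [mul_pow, Real.sq_sqrt hρ0]
  have hlim : Tendsto (fun n : ℕ => ε * a / 2 * √((n : ℝ) + 1)) atTop atTop :=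
    (Real.tendsto_sqrt_atTop.comp
      (tendsto_atTop_add_const_right _ _ tendsto_natCast_atTop_atTop)).const_mul_atTop
        (by positivity)
  filter_upwards [hlow, hlim.eventually_gt_atTop C] with n hn hn'
  have hu : 0 < √((n : ℝ) + 1) := Real.sqrt_pos.2 (by positivity)
  refine ⟨lt_of_lt_of_le (by positivity) hn, ?_⟩
  calc expDist T (noisyLaw μ ρ n) ≤ C + √ρ * W * √(n + 1) := hup ρ n
    _ < ε * a / 2 * √(n + 1) + ε * a / 2 * √(n + 1) :=
      add_lt_add_of_lt_of_le hn' (mul_le_mul_of_nonneg_right hsq hu.le)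
    _ = ε * (a * √(n + 1)) := by ring
    _ ≤ _ := by gcongr

theorem not_distNoiseSensitive [Group.FG G] (hTf : T.Finite) (hT : Subgroup.closure T = ⊤)
    (hμ : μ.support.Finite) {f : G →* Multiplicative ℤ}
    {s t : G} (hs : s ∈ μ.support) (ht : t ∈ μ.support) (hf : f (t * s⁻¹) ≠ 1) :
    ¬ DistNoiseSensitive T μ := by
  intro hsens
  obtain ⟨ρ, hρ, hρ1, hev⟩ := exists_expDist_noisyLaw_lt hTf hT hμ hs ht hf
    (by norm_num : (0 : ℝ) < 1 / 2)
  have h1 := hsens ρ hρ hρ1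
  have h2 : liminf (fun n => ((expDist T (noisyLaw μ ρ n) / expDist T (indepLaw μ n) : ℝ) : EReal))
      atTop ≤ ((1 / 2 : ℝ) : EReal) := by
    refine liminf_le_of_frequently_le' (hev.mono fun n hn => ?_).frequently
    exact EReal.coe_le_coe_iff.2 ((div_le_iff₀ hn.1).2 hn.2.le)
  have h3 := h1.trans h2
  rw [← EReal.coe_one, EReal.coe_le_coe_iff] at h3
  norm_num at h3

theorem not_partiallyDistNoiseSensitive [Group.FG G] (hTf : T.Finite)
    (hT : Subgroup.closure T = ⊤) (hμ : μ.support.Finite) {f : G →* Multiplicative ℤ}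
    {s t : G} (hs : s ∈ μ.support) (ht : t ∈ μ.support) (hf : f (t * s⁻¹) ≠ 1) :
    ¬ PartiallyDistNoiseSensitive T μ := by
  rintro ⟨c, hc, hsens⟩
  obtain ⟨ρ, hρ, hρ1, hev⟩ := exists_expDist_noisyLaw_lt hTf hT hμ hs ht hf hc
  obtain ⟨n, hn, hn'⟩ := (hev.and (hsens ρ hρ hρ1)).exists
  exact absurd hn' (not_le.2 hn.2)

end Distance

end

end NoiseWalk

theorem proposition5p2 {G : Type*} [CommGroup G] [Group.FG G] [Infinite G]
    (μ : PMF G) (hfin : μ.support.Finite)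
    (hμ : ∀ (g : G) (H : Subgroup G), (H : Set G).Finite → ∃ s ∈ μ.support, g⁻¹ * s ∉ H) :
    NoiseWalk.EntropyNoiseSensitive μ ∧
    (∀ T : Set G, T.Finite → Subgroup.closure T = ⊤ →
      ¬ NoiseWalk.DistNoiseSensitive T μ ∧ ¬ NoiseWalk.PartiallyDistNoiseSensitive T μ) ∧
    ¬ NoiseWalk.L1NoiseSensitive μ := by
  obtain ⟨ι, _, ⟨i⟩, s₀, s, f, hs₀, hs, hf, -, -⟩ :=
    NoiseWalk.exists_dual_differences _ hfin hμ
  exact ⟨NoiseWalk.entropyNoiseSensitive hfin hμ,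
    fun T hTf hT => ⟨NoiseWalk.not_distNoiseSensitive hTf hT hfin hs₀ (hs i) (hf i),
      NoiseWalk.not_partiallyDistNoiseSensitive hTf hT hfin hs₀ (hs i) (hf i)⟩,
    NoiseWalk.not_l1NoiseSensitive hfin hs₀ (hs i) (hf i)⟩
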